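/- Let $q_E\colon E\to M$ be a smooth real vector bundle over a smooth manifold. The generalised tangent bundle $\mathbb TE=TE\oplus T^*E\to E$ carries the pairing $\langle(u,\alpha),(v,\beta)\rangle=\alpha(v)+\beta(u)$ and the Courant--Dorfman bracket $[\![(X,\theta),(Y,\omega)]\!]=([X,Y],\mathcal L_X\omega-\iota_Y\mathbf d\theta)$, and it is a double vector bundle with sides $E$ and $TM\oplus E^*$ over $M$ (projection $\Phi_E\colon\mathbb TE\to TM\oplus E^*$). A \emph{linear generalised complex structure} on $E$ is a smooth vector bundle morphism $\mathcal J\colon\mathbb TE\to\mathbb TE$ over $\mathrm{id}_E$ with $\mathcal J^2=-1$, orthogonal for the pairing, with vanishing Nijenhuis tensor $$[\![\xi,\eta]\!]-[\![\mathcal J\xi,\mathcal J\eta]\!]+\mathcal J\big([\![\mathcal J\xi,\eta]\!]+[\![\xi,\mathcal J\eta]\!]\big)=0\qquad(\xi,\eta\in\Gamma(\mathbb TE)),$$ which is a morphism of double vector bundles, i.e. also a vector bundle morphism from $\mathbb TE\to TM\oplus E^*$ to itself over some smooth vector bundle morphism $j$ of $TM\oplus E^*$ over $\mathrm{id}_M$.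 A \emph{complex VB-Dirac structure} in $\mathbb T_{\mathbb C}E=T_{\mathbb C}E\oplus T^*_{\mathbb C}E$ is a smooth complex subbundle $D\subseteq\mathbb T_{\mathbb C}E\to E$ that equals its own orthogonal for the complexified pairing, whose smooth sections are closed under the complexified Courant--Dorfman bracket, and which is a sub-double vector bundle of $\mathbb T_{\mathbb C}E$ over $E$ and some smooth complex subbundle $U\subseteq T_{\mathbb C}M\oplus E_{\mathbb C}^*$. Then linear generalised complex structures on $E$ are equivalent to pairs of transverse, complex conjugate complex VB-Dirac structures: the assignment $\mathcal J\mapsto(D_+,D_-)$, where $D_\pm\subseteq\mathbb T_{\mathbb C}E$ is the $\pm i$-eigenbundle of the complexification $\mathcal J_{\mathbb C}$, is a bijection from the set of linear generalised complex structures on $E$ onto the set of pairs $(D_+,D_-)$ of complex VB-Dirac structures in $\mathbb T_{\mathbb C}E$ with $\mathbb T_{\mathbb C}E=D_+\oplus D_-$ and $D_-=\overline{D_+}$. -/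

import Mathlib

open Bundle Set VectorField
open scoped Manifold ContDiff TensorProduct Topology

noncomputable section

namespace LinearGCS

/-! ### Complexification of real vector spaces, maps and bundles -/

section Complexification

/-- The element `a + i b` of the complexification `V_ℂ = ℂ ⊗ V`. -/
def cx {V : Type*} [AddCommGroup V] [Module ℝ V] (a b : V) : ℂ ⊗[ℝ] V :=
  (1 : ℂ) ⊗ₜ[ℝ] a + Complex.I ⊗ₜ[ℝ] b

/-- Complex conjugation `a + i b ↦ a - i b` on `V_ℂ`. -/
def conj (V : Type*) [AddCommGroup V] [Module ℝ V] : ℂ ⊗[ℝ] V →ₗ[ℝ] ℂ ⊗[ℝ] V :=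
  LinearMap.rTensor V Complex.conjAe.toLinearMap

theorem conj_cx {V : Type*} [AddCommGroup V] [Module ℝ V] (a b : V) :
    conj V (cx a b) = cx a (-b) := by
  simp [conj, cx, TensorProduct.neg_tmul, TensorProduct.tmul_neg]

variable {EB : Type*} [NormedAddCommGroup EB] [NormedSpace ℝ EB]
  {HB : Type*} [TopologicalSpace HB] (IB : ModelWithCorners ℝ EB HB)
  {B : Type*} [TopologicalSpace B] [ChartedSpace HB B]
  (FV : Type*) [NormedAddCommGroup FV] [NormedSpace ℝ FV]
  {V : B → Type*} [∀ x, AddCommGroup (V x)] [∀ x, Module ℝ (V x)]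
  [TopologicalSpace (TotalSpace FV V)] [∀ x, TopologicalSpace (V x)]
  [FiberBundle FV V] [VectorBundle ℝ FV V]

/-- The section `s` of the vector bundle `V → B` is smooth on `N`. -/
def SmoothSectionOn (s : ∀ x, V x) (N : Set B) : Prop :=
  ContMDiffOn IB (IB.prod 𝓘(ℝ, FV)) ∞ (fun x => TotalSpace.mk' FV x (s x)) N

/-- `A` is a smooth endomorphism (over the identity of `B`) of the vector bundle `V → B`. -/
def SmoothEndomorphism (A : ∀ x, V x →ₗ[ℝ] V x) : Prop :=
  ContMDiff (IB.prod 𝓘(ℝ, FV)) (IB.prod 𝓘(ℝ, FV)) ∞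
    (fun p : TotalSpace FV V => TotalSpace.mk' FV p.1 (A p.1 p.2))

/-- `D` is a smooth complex vector subbundle of `V_ℂ → B`: near every point it is spanned by a
smooth complex frame `a₁ + i b₁, …, a_k + i b_k`. -/
def IsComplexSubbundle (D : ∀ x, Submodule ℂ (ℂ ⊗[ℝ] V x)) : Prop :=
  ∀ x₀ : B, ∃ N : Set B, IsOpen N ∧ x₀ ∈ N ∧ ∃ (k : ℕ) (a b : Fin k → ∀ x, V x),
    (∀ i, SmoothSectionOn IB FV (a i) N) ∧ (∀ i, SmoothSectionOn IB FV (b i) N) ∧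
    ∀ x ∈ N, LinearIndependent ℂ (fun i => cx (a i x) (b i x)) ∧
      Submodule.span ℂ (range fun i => cx (a i x) (b i x)) = D x

end Complexification

/-! ### The standard Courant algebroid `𝕋N = TN ⊕ T*N` of a manifold `N` -/

section Courant

variable {EN : Type*} [NormedAddCommGroup EN] [NormedSpace ℝ EN]
  {HN : Type*} [TopologicalSpace HN] (IN : ModelWithCorners ℝ EN HN)
  {N : Type*} [TopologicalSpace N] [ChartedSpace HN N]

/-- The cotangent bundle `T*N → N`. -/
abbrev CotangentSpace : N → Type _ :=
  fun x => TangentSpace IN x →L[ℝ] Bundle.Trivial N ℝ x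

/-- The generalised tangent bundle `𝕋N = TN ⊕ T*N → N`. -/
abbrev GenTangent : N → Type _ :=
  fun x => TangentSpace IN x × CotangentSpace IN x

/-- The model fibre of `𝕋N → N`. -/
abbrev GenTangentModel (EN : Type*) [NormedAddCommGroup EN] [NormedSpace ℝ EN] : Type _ :=
  EN × (EN →L[ℝ] ℝ)

/-- The symmetric pairing `⟨(u, α), (v, β)⟩ = α(v) + β(u)` on `𝕋_x N`. -/
def pairing (x : N) : LinearMap.BilinForm ℝ (GenTangent IN x) :=
  LinearMap.mk₂ ℝ (fun ξ η => (ξ.2 η.1 + η.2 ξ.1 : ℝ))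
    (fun a b c => by simp; ring) (fun r a b => by simp; ring)
    (fun a b c => by simp; ring) (fun r a b => by simp; ring)

/-- The `1`-form `θ` in the preferred chart at `x₀`. -/
def oneFormInChart (θ : ∀ x : N, CotangentSpace IN x) (x₀ : N) : EN → (EN →L[ℝ] ℝ) :=
  fun y => (θ ((extChartAt IN x₀).symm y)).comp
    (mfderivWithin 𝓘(ℝ, EN) IN (extChartAt IN x₀).symm (range IN) y)

/-- The contraction `ι_u (dθ) ∈ T*_{x₀}N` of the exterior derivative of the `1`-form `θ` with
`u ∈ T_{x₀}N`. In the chart at `x₀`, `dθ(u, v) = (D_u θ)(v) - (D_v θ)(u)`. -/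
def contractExtDeriv (θ : ∀ x : N, CotangentSpace IN x) (x₀ : N) (u : TangentSpace IN x₀) :
    CotangentSpace IN x₀ :=
  let A : TangentSpace IN x₀ →L[ℝ] EN := mfderiv IN 𝓘(ℝ, EN) (extChartAt IN x₀) x₀
  let Dθ : EN →L[ℝ] EN →L[ℝ] ℝ :=
    fderivWithin ℝ (oneFormInChart IN θ x₀) (range IN) (extChartAt IN x₀ x₀)
  (Dθ (A u) - Dθ.flip (A u)).comp A

/-- The differential `df ∈ T*_{x₀}N` of a function. -/
def differential (f : N → ℝ) (x₀ : N) : CotangentSpace IN x₀ :=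
  mfderiv IN 𝓘(ℝ, ℝ) f x₀

/-- The Lie derivative of a `1`-form: `L_X β = d(β(X)) + ι_X dβ`. -/
def lieDerivative (X : ∀ x : N, TangentSpace IN x) (β : ∀ x : N, CotangentSpace IN x) (x₀ : N) :
    CotangentSpace IN x₀ :=
  differential IN (fun x => β x (X x)) x₀ + contractExtDeriv IN β x₀ (X x₀)

/-- The Courant-Dorfman bracket `⟦(X, θ), (Y, β)⟧ = ([X, Y], L_X β - ι_Y dθ)`. -/
def dorfman (ξ η : ∀ x : N, GenTangent IN x) (x₀ : N) : GenTangent IN x₀ :=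
  (mlieBracket IN (fun x => (ξ x).1) (fun x => (η x).1) x₀,
    lieDerivative IN (fun x => (ξ x).1) (fun x => (η x).2) x₀
      - contractExtDeriv IN (fun x => (ξ x).2) x₀ (η x₀).1)

variable [IsManifold IN 1 N]

/-- `ξ` is a (global) smooth section of `𝕋N`. -/
def SmoothSection (ξ : ∀ x : N, GenTangent IN x) : Prop :=
  SmoothSectionOn IN (GenTangentModel EN) ξ univ

/-- `𝒥 : 𝕋N → 𝕋N` is a generalised complex structure on `N`: a smooth orthogonal vector bundle
endomorphism with `𝒥² = -1` and vanishing Nijenhuis tensor. -/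
structure IsGeneralisedComplex (𝒥 : ∀ x : N, GenTangent IN x →ₗ[ℝ] GenTangent IN x) : Prop where
  smooth : SmoothEndomorphism IN (GenTangentModel EN) 𝒥
  sq : ∀ x ξ, 𝒥 x (𝒥 x ξ) = -ξ
  orthogonal : ∀ x ξ η, pairing IN x (𝒥 x ξ) (𝒥 x η) = pairing IN x ξ η
  nijenhuis : ∀ ξ η : ∀ x : N, GenTangent IN x, SmoothSection IN ξ → SmoothSection IN η → ∀ x,
    dorfman IN ξ η x
      - dorfman IN (fun y => 𝒥 y (ξ y)) (fun y => 𝒥 y (η y)) x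
      + 𝒥 x (dorfman IN (fun y => 𝒥 y (ξ y)) η x + dorfman IN ξ (fun y => 𝒥 y (η y)) x) = 0

/-- `D ⊆ 𝕋_ℂ N` is a complex Dirac structure: a smooth complex subbundle, equal to its own
orthogonal for the complex bilinear pairing, whose sections `a + i b` are closed under the
complex bilinear extension of the Courant-Dorfman bracket. -/
structure IsComplexDirac (D : ∀ x : N, Submodule ℂ (ℂ ⊗[ℝ] GenTangent IN x)) : Prop where
  subbundle : IsComplexSubbundle IN (GenTangentModel EN) D
  lagrangian : ∀ x ξ, ξ ∈ D x ↔
    ∀ η ∈ D x, LinearMap.BilinForm.baseChange ℂ (pairing IN x) ξ η = 0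
  involutive : ∀ a b c d : ∀ x : N, GenTangent IN x,
    SmoothSection IN a → SmoothSection IN b → SmoothSection IN c → SmoothSection IN d →
    (∀ x, cx (a x) (b x) ∈ D x) → (∀ x, cx (c x) (d x) ∈ D x) →
    ∀ x, cx (dorfman IN a c x - dorfman IN b d x) (dorfman IN a d x + dorfman IN b c x) ∈ D x

end Courant

/-! ### The double vector bundle `𝕋E = TE ⊕ T*E` over `E` and `TM ⊕ E*`

The base point of `𝕋E → E` is an element `p` of the manifold `TotalSpace F E`. -/

section DoubleVectorBundle

variable {EM : Type*} [NormedAddCommGroup EM] [NormedSpace ℝ EM]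
  {H : Type*} [TopologicalSpace H] (I : ModelWithCorners ℝ EM H)
  {M : Type*} [TopologicalSpace M] [ChartedSpace H M]
  (F : Type*) [NormedAddCommGroup F] [NormedSpace ℝ F]
  (E : M → Type*) [∀ x, AddCommGroup (E x)] [∀ x, Module ℝ (E x)]
  [TopologicalSpace (TotalSpace F E)] [∀ x, TopologicalSpace (E x)]
  [FiberBundle F E] [VectorBundle ℝ F E]

/-- The side bundle `TM ⊕ E* → M`. -/
abbrev Side : M → Type _ :=
  fun m => TangentSpace I m × (E m →L[ℝ] Bundle.Trivial M ℝ m)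

/-- The model fibre of `TM ⊕ E* → M`. -/
abbrev SideModel (EM F : Type*) [NormedAddCommGroup EM] [NormedSpace ℝ EM]
    [NormedAddCommGroup F] [NormedSpace ℝ F] : Type _ :=
  EM × (F →L[ℝ] ℝ)

/-- The tangent space of the manifold `E` at `p`. -/
abbrev TE (p : TotalSpace F E) : Type _ := TangentSpace (I.prod 𝓘(ℝ, F)) p

/-- The fibre `T_pE ⊕ T*_pE` of the generalised tangent bundle of the manifold `E`. -/
abbrev GenTE : TotalSpace F E → Type _ := GenTangent (I.prod 𝓘(ℝ, F))

/-- The derivative `Tq_E : T_pE → T_{q(p)}M` of the bundle projection. -/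
def Tq (p : TotalSpace F E) : TE I F E p →L[ℝ] TangentSpace I p.1 :=
  mfderiv (I.prod 𝓘(ℝ, F)) I (TotalSpace.proj : TotalSpace F E → M) p

/-- The vertical lift `E_{q(p)} → T_pE`, `f ↦ d/dt|₀ (p + t f)`: the derivative at `0` of the
inclusion `f ↦ p + f` of the fibre, which is identified with the model fibre by a linear
isomorphism. -/
def verticalLift (p : TotalSpace F E) : E p.1 →L[ℝ] TE I F E p :=
  let L : E p.1 ≃L[ℝ] F := (trivializationAt F E p.1).continuousLinearEquivAt ℝ p.1
    (mem_baseSet_trivializationAt F E p.1)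
  let D : F →L[ℝ] TE I F E p := mfderiv 𝓘(ℝ, F) (I.prod 𝓘(ℝ, F))
    (fun f : F => TotalSpace.mk' F p.1 (p.2 + L.symm f)) 0
  D.comp (L : E p.1 →L[ℝ] F)

/-- The projection `r_E : T*_pE → E*_{q(p)}`, the restriction of a covector to vertical vectors. -/
def rE (p : TotalSpace F E) :
    CotangentSpace (I.prod 𝓘(ℝ, F)) p →ₗ[ℝ] (E p.1 →L[ℝ] Bundle.Trivial M ℝ p.1) where
  toFun α := (show TE I F E p →L[ℝ] ℝ from α).comp (verticalLift I F E p)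
  map_add' _ _ := rfl
  map_smul' _ _ := rfl

/-- The bundle projection `Φ_E = Tq_E ⊕ r_E : 𝕋E → TM ⊕ E*`, on the fibre over `p`. -/
def sideProj (p : TotalSpace F E) : GenTE I F E p →ₗ[ℝ] Side I E p.1 :=
  LinearMap.prodMap (Tq I F E p).toLinearMap (rE I F E p)

section Addition

variable {E} {m : M} (e e' : E m)

/-- The tangent space at `(e, e')` of the manifold `E ⊕ E`. It is the fibre product
`T_eE ×_{T_mM} T_{e'}E` through the derivatives of the two projections to `E`. -/
abbrev TEE : Type _ :=
  TangentSpace (I.prod 𝓘(ℝ, F × F)) (TotalSpace.mk' (F × F) (E := E ×ᵇ E) m (e, e'))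

/-- The derivative at `(e, e')` of the first projection `E ⊕ E → E`. -/
def Tfst : TEE I F e e' →L[ℝ] TE I F E ⟨m, e⟩ :=
  mfderiv (I.prod 𝓘(ℝ, F × F)) (I.prod 𝓘(ℝ, F))
    (fun z : TotalSpace (F × F) (E ×ᵇ E) => TotalSpace.mk' F z.1 z.2.1)
    (TotalSpace.mk' (F × F) (E := E ×ᵇ E) m (e, e'))

/-- The derivative at `(e, e')` of the second projection `E ⊕ E → E`. -/
def Tsnd : TEE I F e e' →L[ℝ] TE I F E ⟨m, e'⟩ :=
  mfderiv (I.prod 𝓘(ℝ, F × F)) (I.prod 𝓘(ℝ, F))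
    (fun z : TotalSpace (F × F) (E ×ᵇ E) => TotalSpace.mk' F z.1 z.2.2)
    (TotalSpace.mk' (F × F) (E := E ×ᵇ E) m (e, e'))

/-- The derivative at `(e, e')` of the addition `E ⊕ E → E`. -/
def Tadd : TEE I F e e' →L[ℝ] TE I F E ⟨m, e + e'⟩ :=
  mfderiv (I.prod 𝓘(ℝ, F × F)) (I.prod 𝓘(ℝ, F))
    (fun z : TotalSpace (F × F) (E ×ᵇ E) => TotalSpace.mk' F z.1 (z.2.1 + z.2.2))
    (TotalSpace.mk' (F × F) (E := E ×ᵇ E) m (e, e'))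

/-- The derivative at `e` of the multiplication `E → E` with `r`. -/
def Tsmul (r : ℝ) : TE I F E ⟨m, e⟩ →L[ℝ] TE I F E ⟨m, r • e⟩ :=
  mfderiv (I.prod 𝓘(ℝ, F)) (I.prod 𝓘(ℝ, F))
    (fun z : TotalSpace F E => TotalSpace.mk' F z.1 (r • z.2)) ⟨m, e⟩

variable {e e'}

/-- `ζ` is the sum of `ξ` and `η` in the vector bundle `𝕋E → TM ⊕ E*`. For tangent vectors,
`Tq_E(u) = Tq_E(v)` and `u +_{TM} v` is the image of `(u, v) ∈ T_{(e, e')}(E ⊕ E)` under the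
derivative of the addition of `E`. For covectors with the same projection to `E*`, the sum
`α +_{E*} β` is given by `(α +_{E*} β)(u +_{TM} v) = α(u) + β(v)` for all such `u, v`
(the condition implies that the projections of `α`, `β` and `α +_{E*} β` to `E*` agree). -/
def IsSideAdd (ξ : GenTE I F E ⟨m, e⟩) (η : GenTE I F E ⟨m, e'⟩)
    (ζ : GenTE I F E ⟨m, e + e'⟩) : Prop :=
  (∃ z : TEE I F e e', Tfst I F e e' z = ξ.1 ∧ Tsnd I F e e' z = η.1 ∧ Tadd I F e e' z = ζ.1) ∧
  ∀ z : TEE I F e e', ζ.2 (Tadd I F e e' z) = (ξ.2 (Tfst I F e e' z) + η.2 (Tsnd I F e e' z) : ℝ)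

/-- `ζ` is the `r`-multiple of `ξ` in the vector bundle `𝕋E → TM ⊕ E*`. -/
def IsSideSMul (r : ℝ) (ξ : GenTE I F E ⟨m, e⟩) (ζ : GenTE I F E ⟨m, r • e⟩) : Prop :=
  ζ.1 = Tsmul I F e r ξ.1 ∧
  (∀ u : TE I F E ⟨m, e⟩, ζ.2 (Tsmul I F e r u) = (r * ξ.2 u : ℝ)) ∧
  rE I F E ⟨m, r • e⟩ ζ.2 = rE I F E ⟨m, e⟩ ξ.2

/-- `ζ` is the sum of `ξ` and `η` in the vector bundle `𝕋_ℂ E → T_ℂ M ⊕ E*_ℂ`. -/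
def IsComplexSideAdd (ξ : ℂ ⊗[ℝ] GenTE I F E ⟨m, e⟩) (η : ℂ ⊗[ℝ] GenTE I F E ⟨m, e'⟩)
    (ζ : ℂ ⊗[ℝ] GenTE I F E ⟨m, e + e'⟩) : Prop :=
  ∃ a b c d f g, ξ = cx a b ∧ η = cx c d ∧ ζ = cx f g ∧
    IsSideAdd I F a c f ∧ IsSideAdd I F b d g

/-- `ζ` is the `r`-multiple of `ξ` in the (real) vector bundle `𝕋_ℂ E → T_ℂ M ⊕ E*_ℂ`. -/
def IsComplexSideSMul (r : ℝ) (ξ : ℂ ⊗[ℝ] GenTE I F E ⟨m, e⟩)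
    (ζ : ℂ ⊗[ℝ] GenTE I F E ⟨m, r • e⟩) : Prop :=
  ∃ a b f g, ξ = cx a b ∧ ζ = cx f g ∧ IsSideSMul I F r a f ∧ IsSideSMul I F r b g

end Addition

variable [IsManifold I ∞ M] [ContMDiffVectorBundle ∞ F E I]

/-- The endomorphism `𝒥` of `𝕋E → E` is a morphism of double vector bundles over a side morphism
`j` of `TM ⊕ E*`: besides being a vector bundle morphism over the identity of `E`, it is a vector
bundle morphism from `𝕋E → TM ⊕ E*` to itself over `j`. (Such a map always induces a core
morphism.) -/
structure IsLinearEndomorphism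
    (𝒥 : ∀ p : TotalSpace F E, GenTE I F E p →ₗ[ℝ] GenTE I F E p) : Prop where
  smooth : SmoothEndomorphism (I.prod 𝓘(ℝ, F)) (GenTangentModel (EM × F)) 𝒥
  side : ∃ j : ∀ m : M, Side I E m →ₗ[ℝ] Side I E m,
    SmoothEndomorphism I (SideModel EM F) j ∧
      ∀ p ξ, sideProj I F E p (𝒥 p ξ) = j p.1 (sideProj I F E p ξ)
  add : ∀ (m : M) (e e' : E m) (ξ : GenTE I F E ⟨m, e⟩) (η : GenTE I F E ⟨m, e'⟩)
    (ζ : GenTE I F E ⟨m, e + e'⟩), IsSideAdd I F ξ η ζ →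
      IsSideAdd I F (𝒥 ⟨m, e⟩ ξ) (𝒥 ⟨m, e'⟩ η) (𝒥 ⟨m, e + e'⟩ ζ)
  smul : ∀ (r : ℝ) (m : M) (e : E m) (ξ : GenTE I F E ⟨m, e⟩) (ζ : GenTE I F E ⟨m, r • e⟩),
    IsSideSMul I F r ξ ζ → IsSideSMul I F r (𝒥 ⟨m, e⟩ ξ) (𝒥 ⟨m, r • e⟩ ζ)

/-- `𝒥` is a linear generalised complex structure on the vector bundle `E → M`. -/
def IsLinearGeneralisedComplex
    (𝒥 : ∀ p : TotalSpace F E, GenTE I F E p →ₗ[ℝ] GenTE I F E p) : Prop :=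
  IsGeneralisedComplex (I.prod 𝓘(ℝ, F)) 𝒥 ∧ IsLinearEndomorphism I F E 𝒥

/-- `(D; U, E; M)` is a sub-double vector bundle of `(𝕋_ℂ E; T_ℂ M ⊕ E*_ℂ, E; M)` that is complex
linear over `E`: `D` and `U` are smooth complex subbundles over `E` and over `M`, `D` projects
onto `U`, and the fibres of `D → U` are linear subspaces of the fibres of
`𝕋_ℂ E → T_ℂ M ⊕ E*_ℂ`. (A submanifold that is closed under the operations of a vector bundle is
a vector subbundle, so that `D → U` is then a smooth vector subbundle.) -/
structure IsSubDoubleVectorBundle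
    (D : ∀ p : TotalSpace F E, Submodule ℂ (ℂ ⊗[ℝ] GenTE I F E p))
    (U : ∀ m : M, Submodule ℂ (ℂ ⊗[ℝ] Side I E m)) : Prop where
  subbundle : IsComplexSubbundle (I.prod 𝓘(ℝ, F)) (GenTangentModel (EM × F)) D
  side_subbundle : IsComplexSubbundle I (SideModel EM F) U
  map_side : ∀ p, (D p).map ((sideProj I F E p).baseChange ℂ) = U p.1
  add_mem : ∀ (m : M) (e e' : E m), ∀ ξ ∈ D ⟨m, e⟩, ∀ η ∈ D ⟨m, e'⟩, ∀ ζ,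
    IsComplexSideAdd I F ξ η ζ → ζ ∈ D ⟨m, e + e'⟩
  smul_mem : ∀ (r : ℝ) (m : M) (e : E m), ∀ ξ ∈ D ⟨m, e⟩, ∀ ζ,
    IsComplexSideSMul I F r ξ ζ → ζ ∈ D ⟨m, r • e⟩

/-- `D` is a complex VB-Dirac structure in `𝕋_ℂ E`. -/
def IsComplexVBDirac (D : ∀ p : TotalSpace F E, Submodule ℂ (ℂ ⊗[ℝ] GenTE I F E p)) : Prop :=
  IsComplexDirac (I.prod 𝓘(ℝ, F)) D ∧ ∃ U, IsSubDoubleVectorBundle I F E D U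

/-- `Dplus` and `Dminus` are transverse and complex conjugate complex VB-Dirac structures. -/
structure IsConjugateVBDiracPair
    (Dplus Dminus : ∀ p : TotalSpace F E, Submodule ℂ (ℂ ⊗[ℝ] GenTE I F E p)) : Prop where
  plus : IsComplexVBDirac I F E Dplus
  minus : IsComplexVBDirac I F E Dminus
  transverse : ∀ p, IsCompl (Dplus p) (Dminus p)
  conjugate : ∀ p ξ, ξ ∈ Dminus p ↔ conj (GenTE I F E p) ξ ∈ Dplus p

/-- The eigenbundle of the complexification `𝒥_ℂ : 𝕋_ℂ E → 𝕋_ℂ E` for the eigenvalue `c`. -/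
def eigenbundle (𝒥 : ∀ p : TotalSpace F E, GenTE I F E p →ₗ[ℝ] GenTE I F E p) (c : ℂ)
    (p : TotalSpace F E) : Submodule ℂ (ℂ ⊗[ℝ] GenTE I F E p) :=
  Module.End.eigenspace ((𝒥 p).baseChange ℂ) c

end DoubleVectorBundle

end LinearGCS

end

/-! The heart of the matter is linear algebra on one fibre. If `J² = -1` on a real space `V`, the
`i`-eigenspace of its complexification is `{Jv + iv : v ∈ V}`, that is, the graph of `J` over the
imaginary part (`cx_mem_eigenspace_I`). It is transverse to its conjugate, which is the
`-i`-eigenspace. Conversely, a complex subspace transverse to its conjugate is such a graph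
(`exists_complexStructure`), and the graph determines `J` (`eq_of_eigenspace_eq`).

Applied over every point of `E`, this gives the bijection as soon as each condition on `𝒥` is
translated into a condition on the graph. Smoothness of `𝒥` corresponds to local smooth frames of
the eigenbundle: a family `J vᵢ + i vᵢ` is a complex basis of the eigenspace exactly when the `vᵢ`
and `J vᵢ` form a real basis (`basis_eigenspace_iff`). Orthogonality corresponds to isotropy, and
nondegeneracy of the pairing makes the isotropic eigenspace its own orthogonal
(`orthogonal_iff_isotropic`, `eigenspace_lagrangian`). The Nijenhuis identity for `ξ, η` says, up to
sign, that the bracket of `𝒥ξ + iξ` and `𝒥η + iη` lies in the graph again.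

For linearity, sums and multiples in `𝕋E → TM ⊕ E*` are unique when they exist, and sums exist as
soon as the projections agree (`IsSideAdd.unique`, `exists_isSideAdd`). Hence `𝒥` preserves these
operations if and only if its graph is closed under them, once `𝒥` is known to cover a side map `j`.
That map comes from the same linear algebra on the side bundles of `D₊` and `D₋`, whose
transversality is `isCompl_side`. -/

noncomputable section

namespace LinearGCS

/-! ### Complex structures on a real vector space and their eigenspaces -/

section Algebra

variable {V W : Type*} [AddCommGroup V] [Module ℝ V] [AddCommGroup W] [Module ℝ W]

theorem exists_cx (z : ℂ ⊗[ℝ] V) : ∃ a b : V, z = cx a b := by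
  induction z using TensorProduct.induction_on with
  | zero => exact ⟨0, 0, by simp [cx]⟩
  | tmul c v =>
    refine ⟨c.re • v, c.im • v, ?_⟩
    rw [cx, ← TensorProduct.smul_tmul, ← TensorProduct.smul_tmul, ← TensorProduct.add_tmul]
    congr 1
    apply Complex.ext <;> simp
  | add x y hx hy =>
    obtain ⟨a, b, rfl⟩ := hx
    obtain ⟨c, d, rfl⟩ := hy
    refine ⟨a + c, b + d, ?_⟩
    simp only [cx, TensorProduct.tmul_add]
    abel

theorem cx_inj {a b c d : V} : cx a b = cx c d ↔ a = c ∧ b = d := by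
  refine ⟨fun h => ?_, fun h => by rw [h.1, h.2]⟩
  let re : ℂ ⊗[ℝ] V →ₗ[ℝ] V :=
    TensorProduct.lift ((LinearMap.lsmul ℝ V).comp Complex.reLm)
  let im : ℂ ⊗[ℝ] V →ₗ[ℝ] V :=
    TensorProduct.lift ((LinearMap.lsmul ℝ V).comp Complex.imLm)
  have h₁ := congrArg re h
  have h₂ := congrArg im h
  simp [re, im, cx] at h₁ h₂
  exact ⟨h₁, h₂⟩

theorem cx_add (a b c d : V) : cx a b + cx c d = cx (a + c) (b + d) := by
  simp only [cx, TensorProduct.tmul_add]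
  abel

theorem cx_zero : cx (0 : V) 0 = 0 := by simp [cx]

theorem cx_eq_zero {a b : V} : cx a b = 0 ↔ a = 0 ∧ b = 0 := by
  rw [← cx_zero, cx_inj]

theorem smul_cx (z : ℂ) (a b : V) :
    z • cx a b = cx (z.re • a - z.im • b) (z.re • b + z.im • a) := by
  have h₁ : z = (z.re : ℝ) • (1 : ℂ) + (z.im : ℝ) • Complex.I := by
    apply Complex.ext <;> simp
  have h₂ : z * Complex.I = (z.re : ℝ) • Complex.I - (z.im : ℝ) • (1 : ℂ) := by
    apply Complex.ext <;> simp
  simp only [cx, smul_add, TensorProduct.smul_tmul', smul_eq_mul, mul_one]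
  rw [h₂]
  nth_rw 1 [h₁]
  simp only [TensorProduct.add_tmul, TensorProduct.sub_tmul, TensorProduct.smul_tmul,
    TensorProduct.tmul_add, TensorProduct.tmul_sub]
  abel

theorem I_smul_cx (a b : V) : Complex.I • cx a b = cx (-b) a := by
  simp [smul_cx]

theorem neg_cx (a b : V) : -cx a b = cx (-a) (-b) := by
  simp only [cx, neg_add, TensorProduct.tmul_neg]

theorem sum_cx {ι : Type*} (s : Finset ι) (a b : ι → V) :
    ∑ i ∈ s, cx (a i) (b i) = cx (∑ i ∈ s, a i) (∑ i ∈ s, b i) := by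
  simp only [cx, TensorProduct.tmul_sum, Finset.sum_add_distrib]

theorem baseChange_cx (f : V →ₗ[ℝ] W) (a b : V) :
    f.baseChange ℂ (cx a b) = cx (f a) (f b) := by
  simp [cx]

theorem bilinForm_baseChange_cx (f : LinearMap.BilinForm ℝ V) (a b c d : V) :
    LinearMap.BilinForm.baseChange ℂ f (cx a b) (cx c d)
      = ((f a c - f b d : ℝ) : ℂ) + ((f a d + f b c : ℝ) : ℂ) * Complex.I := by
  simp only [cx, map_add, LinearMap.add_apply, LinearMap.BilinForm.baseChange_tmul]
  apply Complex.ext <;> simp <;> ring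

/-- Membership in the `i`-eigenspace of the complexification of a complex structure `J`. -/
theorem cx_mem_eigenspace_I {J : V →ₗ[ℝ] V} (hJ : ∀ v, J (J v) = -v) {a b : V} :
    cx a b ∈ Module.End.eigenspace (J.baseChange ℂ) Complex.I ↔ a = J b := by
  rw [Module.End.mem_eigenspace_iff, baseChange_cx, I_smul_cx, cx_inj]
  constructor
  · exact fun h => h.2.symm
  · rintro rfl
    exact ⟨hJ b, rfl⟩

/-- Statements about the eigenvalue `i` transfer to `-i` through this, since `-J` is again a complex
structure when `J` is. -/
theorem eigenspace_neg_I (J : V →ₗ[ℝ] V) :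
    Module.End.eigenspace (J.baseChange ℂ) (-Complex.I)
      = Module.End.eigenspace ((-J).baseChange ℂ) Complex.I := by
  ext z
  rw [Module.End.mem_eigenspace_iff, Module.End.mem_eigenspace_iff, LinearMap.baseChange_neg,
    LinearMap.neg_apply, neg_smul, neg_eq_iff_eq_neg]

theorem cx_mem_eigenspace_neg_I {J : V →ₗ[ℝ] V} (hJ : ∀ v, J (J v) = -v) {a b : V} :
    cx a b ∈ Module.End.eigenspace (J.baseChange ℂ) (-Complex.I) ↔ a = -J b := by
  rw [eigenspace_neg_I, cx_mem_eigenspace_I (by simpa using hJ), LinearMap.neg_apply]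

theorem mem_eigenspace_neg_I_iff_conj_mem {J : V →ₗ[ℝ] V} (hJ : ∀ v, J (J v) = -v)
    (z : ℂ ⊗[ℝ] V) :
    z ∈ Module.End.eigenspace (J.baseChange ℂ) (-Complex.I)
      ↔ conj V z ∈ Module.End.eigenspace (J.baseChange ℂ) Complex.I := by
  obtain ⟨a, b, rfl⟩ := exists_cx z
  rw [conj_cx, cx_mem_eigenspace_neg_I hJ, cx_mem_eigenspace_I hJ, map_neg]

theorem isCompl_eigenspace {J : V →ₗ[ℝ] V} (hJ : ∀ v, J (J v) = -v) :
    IsCompl (Module.End.eigenspace (J.baseChange ℂ) Complex.I)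
      (Module.End.eigenspace (J.baseChange ℂ) (-Complex.I)) := by
  constructor
  · rw [Submodule.disjoint_def]
    intro z h₁ h₂
    obtain ⟨a, b, rfl⟩ := exists_cx z
    rw [cx_mem_eigenspace_I hJ] at h₁
    rw [cx_mem_eigenspace_neg_I hJ] at h₂
    have ha : a = 0 := by
      rw [← h₁] at h₂
      have h₃ : (2 : ℝ) • a = 0 := by
        rw [two_smul]
        nth_rw 1 [h₂]
        exact neg_add_cancel a
      exact (smul_eq_zero.mp h₃).resolve_left two_ne_zero
    have hb : b = 0 := by
      have := hJ b
      rw [← h₁, ha, map_zero] at this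
      exact neg_eq_zero.mp this.symm
    rw [ha, hb, cx_zero]
  · rw [codisjoint_iff, eq_top_iff]
    rintro z -
    obtain ⟨a, b, rfl⟩ := exists_cx z
    -- The two summands are the spectral projections `(z - iJz)/2` and `(z + iJz)/2` of `z = a +
    -- ib`, written through their imaginary parts.
    refine Submodule.mem_sup.mpr ⟨cx (J ((1 / 2 : ℝ) • (b - J a))) ((1 / 2 : ℝ) • (b - J a)),
      (cx_mem_eigenspace_I hJ).mpr rfl,
      cx (-J ((1 / 2 : ℝ) • (b + J a))) ((1 / 2 : ℝ) • (b + J a)),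
      (cx_mem_eigenspace_neg_I hJ).mpr rfl, ?_⟩
    rw [cx_add, cx_inj]
    simp only [map_smul, map_sub, map_add, hJ]
    constructor <;> module

/-- A complex structure is determined by its `i`-eigenspace. -/
theorem eq_of_eigenspace_eq {J K : V →ₗ[ℝ] V} (hJ : ∀ v, J (J v) = -v) (hK : ∀ v, K (K v) = -v)
    (h : Module.End.eigenspace (J.baseChange ℂ) Complex.I
      = Module.End.eigenspace (K.baseChange ℂ) Complex.I) : J = K := by
  ext v
  rw [← cx_mem_eigenspace_I hK, ← h, cx_mem_eigenspace_I hJ]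

/-- Transverse and complex conjugate subspaces are the eigenspaces of a complex structure. -/
theorem exists_complexStructure (D D' : Submodule ℂ (ℂ ⊗[ℝ] V)) (hc : IsCompl D D')
    (hconj : ∀ z, z ∈ D' ↔ conj V z ∈ D) :
    ∃ J : V →ₗ[ℝ] V, (∀ v, J (J v) = -v) ∧
      Module.End.eigenspace (J.baseChange ℂ) Complex.I = D ∧
      Module.End.eigenspace (J.baseChange ℂ) (-Complex.I) = D' := by
  have hdisj := Submodule.disjoint_def.mp hc.disjoint
  -- The difference of the two elements is real, hence fixed by conjugation, so it lies in both `D`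
  -- and `D'`.
  have huniq : ∀ a a' v : V, cx a v ∈ D → cx a' v ∈ D → a = a' := by
    intro a a' v h h'
    have h₁ : cx (a - a') 0 ∈ D := by
      have := D.add_mem h (D.neg_mem h')
      rwa [neg_cx, cx_add, add_neg_cancel, ← sub_eq_add_neg] at this
    have h₂ : cx (a - a') 0 ∈ D' := by
      rw [hconj, conj_cx, neg_zero]
      exact h₁
    exact sub_eq_zero.mp (cx_eq_zero.mp (hdisj _ h₁ h₂)).1
  have hex : ∀ v : V, ∃ a, cx a v ∈ D := by
    intro v
    -- Split `2iv = d + d'`. The real parts cancel, so `d - conj d'` lies in `D` and has imaginary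
    -- part `2v`; half of it is the required element.
    have htop : cx 0 ((2 : ℝ) • v) ∈ D ⊔ D' := by rw [hc.sup_eq_top]; trivial
    obtain ⟨d, hd, d', hd', hsum⟩ := Submodule.mem_sup.mp htop
    obtain ⟨a, b, rfl⟩ := exists_cx d
    obtain ⟨a', b', rfl⟩ := exists_cx d'
    rw [cx_add, cx_inj] at hsum
    obtain ⟨h₁, h₂⟩ := hsum
    have ha : a' = -a := (neg_eq_of_add_eq_zero_right h₁).symm
    subst ha
    have hd'' := (hconj _).mp hd'
    rw [conj_cx] at hd''
    have h₃ := D.add_mem hd (D.neg_mem hd'')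
    rw [neg_cx, cx_add, neg_neg, neg_neg, h₂] at h₃
    have h₄ := D.smul_mem ((1 / 2 : ℝ) : ℂ) h₃
    rw [smul_cx] at h₄
    refine ⟨a, ?_⟩
    convert h₄ using 2
    · simp only [Complex.ofReal_re, Complex.ofReal_im]
      module
    · simp only [Complex.ofReal_re, Complex.ofReal_im]
      module
  choose j hj using hex
  let J : V →ₗ[ℝ] V :=
    { toFun := j
      map_add' := fun u v => huniq _ _ (u + v) (hj _) (by
        rw [← cx_add]; exact D.add_mem (hj u) (hj v))
      map_smul' := fun r v => huniq _ _ (r • v) (hj _) (by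
        have := D.smul_mem (r : ℂ) (hj v)
        rw [smul_cx] at this
        simpa using this) }
  -- Multiplying `Jv + iv` by `i` gives `-v + iJv`, which again lies in `D`.
  have hJ : ∀ v, J (J v) = -v := fun v => huniq _ _ (j v) (hj _) (by
    rw [← I_smul_cx]; exact D.smul_mem _ (hj v))
  have hD : Module.End.eigenspace (J.baseChange ℂ) Complex.I = D := by
    ext z
    obtain ⟨a, b, rfl⟩ := exists_cx z
    rw [cx_mem_eigenspace_I hJ]
    exact ⟨fun h => h ▸ hj b, fun h => huniq _ _ b h (hj b)⟩
  refine ⟨J, hJ, hD, ?_⟩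
  ext z
  rw [mem_eigenspace_neg_I_iff_conj_mem hJ, hD, hconj]

/-- Orthogonality of a complex structure amounts to isotropy of its `i`-eigenspace. -/
theorem orthogonal_iff_isotropic (f : LinearMap.BilinForm ℝ V) {J : V →ₗ[ℝ] V}
    (hJ : ∀ v, J (J v) = -v) :
    (∀ a b, f (J a) (J b) = f a b) ↔
      ∀ y ∈ Module.End.eigenspace (J.baseChange ℂ) Complex.I,
      ∀ z ∈ Module.End.eigenspace (J.baseChange ℂ) Complex.I,
        LinearMap.BilinForm.baseChange ℂ f y z = 0 := by
  constructor
  · intro h y hy z hz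
    obtain ⟨a, b, rfl⟩ := exists_cx y
    obtain ⟨c, d, rfl⟩ := exists_cx z
    rw [cx_mem_eigenspace_I hJ] at hy hz
    subst hy hz
    -- An orthogonal complex structure is skew for the form. This kills the imaginary part, while
    -- orthogonality kills the real part.
    have h' : f (J b) d = - f b (J d) := by
      rw [← h (J b) d, hJ, map_neg, LinearMap.neg_apply]
    rw [bilinForm_baseChange_cx, h, h']
    simp
  · intro h a b
    have := h (cx (J a) a) ((cx_mem_eigenspace_I hJ).mpr rfl) (cx (J b) b)
      ((cx_mem_eigenspace_I hJ).mpr rfl)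
    rw [bilinForm_baseChange_cx] at this
    have := congrArg Complex.re this
    simp at this
    linarith

/-- Isotropy gives one inclusion. For the other, pairing `a + ib` with all elements of the
eigenspace shows that `a - Jb` is orthogonal to all of `V`, so nondegeneracy applies. -/
theorem eigenspace_lagrangian (f : LinearMap.BilinForm ℝ V)
    (hf : ∀ v, (∀ w, f v w = 0) → v = 0) {J : V →ₗ[ℝ] V}
    (hJ : ∀ v, J (J v) = -v) (ho : ∀ a b, f (J a) (J b) = f a b) (y : ℂ ⊗[ℝ] V) :
    y ∈ Module.End.eigenspace (J.baseChange ℂ) Complex.I ↔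
      ∀ z ∈ Module.End.eigenspace (J.baseChange ℂ) Complex.I,
        LinearMap.BilinForm.baseChange ℂ f y z = 0 := by
  refine ⟨fun hy z hz => (orthogonal_iff_isotropic f hJ).mp ho y hy z hz, fun h => ?_⟩
  obtain ⟨a, b, rfl⟩ := exists_cx y
  rw [cx_mem_eigenspace_I hJ, ← sub_eq_zero]
  refine hf _ fun w => ?_
  -- The test vector is `-w + iJw`; the real part of its pairing with `a + ib` is `-f(a, w) - f(b,
  -- Jw)`.
  have := h (cx (J (J w)) (J w)) ((cx_mem_eigenspace_I hJ).mpr rfl)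
  rw [bilinForm_baseChange_cx] at this
  have := congrArg Complex.re this
  simp [hJ] at this
  rw [map_sub, LinearMap.sub_apply, ← ho (J b) w, hJ, map_neg, LinearMap.neg_apply]
  linarith

/-- A family `cx (J vᵢ) vᵢ` is a complex basis of the `i`-eigenspace of a complex structure `J` if
and only if the `vᵢ` and `J vᵢ` form a real basis. -/
theorem basis_eigenspace_iff {J : V →ₗ[ℝ] V} (hJ : ∀ v, J (J v) = -v) {k : ℕ}
    (v w : Fin k → V) (hw : ∀ i, w i = J (v i)) :
    (LinearIndependent ℂ (fun i => cx (w i) (v i)) ∧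
      Submodule.span ℂ (range fun i => cx (w i) (v i))
        = Module.End.eigenspace (J.baseChange ℂ) Complex.I) ↔
    Function.Bijective
      (fun p : (Fin k → ℝ) × (Fin k → ℝ) => ∑ i, p.1 i • v i + ∑ i, p.2 i • w i) := by
  obtain rfl : w = fun i => J (v i) := funext hw
  -- Taking imaginary parts identifies the eigenspace with `V` over `ℝ`, and complex coefficients `s
  -- + it` become the real coefficients `s` of `v` and `t` of `Jv`.
  have key : ∀ c : Fin k → ℂ, ∑ i, c i • cx (J (v i)) (v i)
      = cx (J (∑ i, (c i).re • v i + ∑ i, (c i).im • J (v i)))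
        (∑ i, (c i).re • v i + ∑ i, (c i).im • J (v i)) := by
    intro c
    simp only [smul_cx, sum_cx, map_add, map_sum, map_smul, hJ, Finset.sum_add_distrib, smul_neg,
      Finset.sum_neg_distrib, sub_eq_add_neg]
  let toC : (Fin k → ℝ) × (Fin k → ℝ) → Fin k → ℂ := fun p i => ⟨p.1 i, p.2 i⟩
  let A : (Fin k → ℝ) × (Fin k → ℝ) →ₗ[ℝ] V :=
    { toFun := fun p => ∑ i, p.1 i • v i + ∑ i, p.2 i • J (v i)
      map_add' := fun p q => by
        simp only [Prod.fst_add, Prod.snd_add, Pi.add_apply, add_smul, Finset.sum_add_distrib]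
        abel
      map_smul' := fun r p => by
        simp only [Prod.smul_fst, Prod.smul_snd, Pi.smul_apply, smul_eq_mul, mul_smul,
          ← Finset.smul_sum, smul_add, RingHom.id_apply] }
  have keyA : ∀ p, ∑ i, toC p i • cx (J (v i)) (v i) = cx (J (A p)) (A p) := fun p => key (toC p)
  change _ ↔ Function.Bijective A
  constructor
  · rintro ⟨h₁, h₂⟩
    rw [Fintype.linearIndependent_iff] at h₁
    constructor
    · rw [injective_iff_map_eq_zero]
      intro p hp
      have := h₁ (toC p) (by rw [keyA, hp, map_zero, cx_zero])
      ext i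
      · exact congrArg Complex.re (this i)
      · exact congrArg Complex.im (this i)
    · intro y
      have : cx (J y) y ∈ Submodule.span ℂ (range fun i => cx (J (v i)) (v i)) := by
        rw [h₂, cx_mem_eigenspace_I hJ]
      obtain ⟨c, hc⟩ := (Submodule.mem_span_range_iff_exists_fun ℂ).mp this
      rw [key, cx_inj] at hc
      exact ⟨(fun i => (c i).re, fun i => (c i).im), hc.2⟩
  · rintro ⟨h₁, h₂⟩
    constructor
    · rw [Fintype.linearIndependent_iff]
      intro c hc
      rw [key, cx_eq_zero] at hc
      have := (injective_iff_map_eq_zero A).mp h₁ (fun i => (c i).re, fun i => (c i).im) hc.2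
      intro i
      apply Complex.ext
      · exact congrFun (congrArg Prod.fst this) i
      · exact congrFun (congrArg Prod.snd this) i
    · apply le_antisymm
      · rw [Submodule.span_le]
        rintro _ ⟨i, rfl⟩
        exact (cx_mem_eigenspace_I hJ).mpr rfl
      · intro z hz
        obtain ⟨a, b, rfl⟩ := exists_cx z
        rw [cx_mem_eigenspace_I hJ] at hz
        obtain ⟨p, hp⟩ := h₂ b
        rw [hz, ← hp, ← keyA]
        exact (Submodule.mem_span_range_iff_exists_fun ℂ).mpr ⟨_, rfl⟩

/-- The `i`-eigenspace of a complex structure on a finite-dimensional space has a basis. -/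
theorem exists_basis_eigenspace [FiniteDimensional ℝ V] {J : V →ₗ[ℝ] V}
    (hJ : ∀ v, J (J v) = -v) :
    ∃ (k : ℕ) (v : Fin k → V), Function.Bijective
      (fun p : (Fin k → ℝ) × (Fin k → ℝ) => ∑ i, p.1 i • v i + ∑ i, p.2 i • J (v i)) := by
  let D := Module.End.eigenspace (J.baseChange ℂ) Complex.I
  let b := Module.finBasis ℂ D
  choose a v hv using fun i => exists_cx ((b i : D) : ℂ ⊗[ℝ] V)
  have ha : ∀ i, a i = J (v i) := fun i =>
    (cx_mem_eigenspace_I hJ).mp (by rw [← hv]; exact (b i).2)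
  refine ⟨_, v, (basis_eigenspace_iff hJ v (fun i => J (v i)) (fun _ => rfl)).mp ?_⟩
  have hfun : (fun i => cx (J (v i)) (v i)) = fun i => ((b i : D) : ℂ ⊗[ℝ] V) := by
    ext1 i
    rw [hv, ha]
  rw [hfun]
  refine ⟨b.linearIndependent.map' D.subtype D.ker_subtype, ?_⟩
  have : (range fun i => ((b i : D) : ℂ ⊗[ℝ] V)) = D.subtype '' range b := by
    rw [← range_comp]; rfl
  rw [this, Submodule.span_image, b.span_eq, Submodule.map_top, Submodule.range_subtype]

end Algebra

/-! ### Smoothness of a complex structure versus smooth frames of its eigenbundle -/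

section Frames

variable {EB : Type*} [NormedAddCommGroup EB] [NormedSpace ℝ EB]
  {HB : Type*} [TopologicalSpace HB] {IB : ModelWithCorners ℝ EB HB}
  {B : Type*} [TopologicalSpace B] [ChartedSpace HB B]
  {FV : Type*} [NormedAddCommGroup FV] [NormedSpace ℝ FV]
  {V : B → Type*} [TopologicalSpace (TotalSpace FV V)]

/-- The linear map `(s, t) ↦ ∑ sᵢ vᵢ(x) + ∑ tᵢ wᵢ(x)`, read in a trivialization. -/
def frameMap (e : Trivialization FV (π FV V)) {k : ℕ} (v w : Fin k → ∀ x, V x) (x : B) :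
    (Fin k → ℝ) × (Fin k → ℝ) →L[ℝ] FV :=
  ∑ i, ContinuousLinearMap.smulRightL ℝ _ FV
      ((ContinuousLinearMap.proj i).comp (ContinuousLinearMap.fst ℝ (Fin k → ℝ) (Fin k → ℝ)))
      (e ⟨x, v i x⟩).2 +
    ∑ i, ContinuousLinearMap.smulRightL ℝ _ FV
      ((ContinuousLinearMap.proj i).comp (ContinuousLinearMap.snd ℝ (Fin k → ℝ) (Fin k → ℝ)))
      (e ⟨x, w i x⟩).2

theorem contMDiffAt_frameMap {e : Trivialization FV (π FV V)} {k : ℕ}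
    {v w : Fin k → ∀ x, V x} {x₀ : B}
    (hv : ∀ i, ContMDiffAt IB 𝓘(ℝ, FV) ∞ (fun x => (e ⟨x, v i x⟩).2) x₀)
    (hw : ∀ i, ContMDiffAt IB 𝓘(ℝ, FV) ∞ (fun x => (e ⟨x, w i x⟩).2) x₀) :
    ContMDiffAt IB 𝓘(ℝ, (Fin k → ℝ) × (Fin k → ℝ) →L[ℝ] FV) ∞ (frameMap e v w) x₀ := by
  unfold frameMap
  refine ContMDiffAt.add ?_ ?_
  · exact contMDiffAt_finsetSum fun i _ =>
      (ContinuousLinearMap.contMDiff (L := ContinuousLinearMap.smulRightL ℝ _ FV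
        ((ContinuousLinearMap.proj i).comp
          (ContinuousLinearMap.fst ℝ (Fin k → ℝ) (Fin k → ℝ))))).contMDiffAt.comp x₀ (hv i)
  · exact contMDiffAt_finsetSum fun i _ =>
      (ContinuousLinearMap.contMDiff (L := ContinuousLinearMap.smulRightL ℝ _ FV
        ((ContinuousLinearMap.proj i).comp
          (ContinuousLinearMap.snd ℝ (Fin k → ℝ) (Fin k → ℝ))))).contMDiffAt.comp x₀ (hw i)

variable [∀ x, AddCommGroup (V x)] [∀ x, Module ℝ (V x)] [∀ x, TopologicalSpace (V x)] [FiberBundle FV V]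

theorem SmoothEndomorphism.comp {A C : ∀ x, V x →ₗ[ℝ] V x} (hA : SmoothEndomorphism IB FV A)
    (hC : SmoothEndomorphism IB FV C) : SmoothEndomorphism IB FV fun x => A x ∘ₗ C x :=
  ContMDiff.comp hA hC

theorem SmoothEndomorphism.smoothSectionOn {A : ∀ x, V x →ₗ[ℝ] V x}
    (hA : SmoothEndomorphism IB FV A) {s : ∀ x, V x} {N : Set B}
    (hs : SmoothSectionOn IB FV s N) : SmoothSectionOn IB FV (fun x => A x (s x)) N :=
  ContMDiff.comp_contMDiffOn hA hs

/-- A complex structure `J` satisfies `-J = J³`. -/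
theorem SmoothEndomorphism.neg {J : ∀ x, V x →ₗ[ℝ] V x} (hs : SmoothEndomorphism IB FV J)
    (hJ : ∀ x v, J x (J x v) = -v) : SmoothEndomorphism IB FV fun x => -J x := by
  have : (fun x => -J x) = fun x => J x ∘ₗ (J x ∘ₗ J x) := by
    funext x
    ext v
    simp [hJ]
  rw [this]
  exact hs.comp (hs.comp hs)

theorem frameMap_apply (e : Trivialization FV (π FV V)) [e.IsLinear ℝ] {k : ℕ}
    (v w : Fin k → ∀ x, V x) {x : B} (hx : x ∈ e.baseSet) (p : (Fin k → ℝ) × (Fin k → ℝ)) :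
    frameMap e v w x p
      = e.continuousLinearEquivAt ℝ x hx (∑ i, p.1 i • v i x + ∑ i, p.2 i • w i x) := by
  have h : ∀ y : V x, (e ⟨x, y⟩).2 = e.continuousLinearEquivAt ℝ x hx y := fun _ => rfl
  simp only [frameMap, h, add_apply, sum_apply, map_add, map_sum, map_smul]
  rfl

/-- This places the pointwise basis condition in a fixed space of operators, where invertibility is
open and inversion is smooth. -/
theorem frameMap_isInvertible_iff [FiniteDimensional ℝ FV] (e : Trivialization FV (π FV V))
    [e.IsLinear ℝ] {k : ℕ} (v w : Fin k → ∀ x, V x) {x : B} (hx : x ∈ e.baseSet) :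
    (frameMap e v w x).IsInvertible ↔ Function.Bijective
      (fun p : (Fin k → ℝ) × (Fin k → ℝ) => ∑ i, p.1 i • v i x + ∑ i, p.2 i • w i x) := by
  have h₁ : ⇑(frameMap e v w x) = e.continuousLinearEquivAt ℝ x hx ∘
      fun p : (Fin k → ℝ) × (Fin k → ℝ) => ∑ i, p.1 i • v i x + ∑ i, p.2 i • w i x :=
    funext fun p => frameMap_apply e v w hx p
  have h₂ : (frameMap e v w x).IsInvertible ↔ Function.Bijective (frameMap e v w x) := by
    constructor
    · rintro ⟨A, hA⟩
      rw [← hA]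
      exact A.bijective
    · intro h
      exact ⟨(LinearEquiv.ofBijective (frameMap e v w x).toLinearMap h).toContinuousLinearEquiv,
        by ext p <;> rfl⟩
  rw [h₂, h₁]
  exact (e.continuousLinearEquivAt ℝ x hx).bijective.of_comp_iff' _

variable [VectorBundle ℝ FV V]

/-- The `i`-eigenbundle of a smooth complex structure is a smooth complex subbundle. -/
theorem isComplexSubbundle_eigenspace [FiniteDimensional ℝ FV] [ContMDiffVectorBundle ∞ FV V IB]
    {J : ∀ x, V x →ₗ[ℝ] V x} (hs : SmoothEndomorphism IB FV J) (hJ : ∀ x v, J x (J x v) = -v) :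
    IsComplexSubbundle IB FV fun x =>
      Module.End.eigenspace ((J x).baseChange ℂ) Complex.I := by
  intro x₀
  let e := trivializationAt FV V x₀
  have hx₀ : x₀ ∈ e.baseSet := mem_baseSet_trivializationAt FV V x₀
  have : FiniteDimensional ℝ (V x₀) :=
    (e.continuousLinearEquivAt ℝ x₀ hx₀).symm.toLinearEquiv.finiteDimensional
  obtain ⟨k, v₀, hv₀⟩ := exists_basis_eigenspace (hJ x₀)
  -- The basis at `x₀` is extended with constant coordinates. The `J vᵢ` are smooth too, and the
  -- `vᵢ` and `J vᵢ` together remain a basis near `x₀` because invertible operators form an open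
  -- set.
  let v : Fin k → ∀ x, V x := fun i x => e.symm x (e ⟨x₀, v₀ i⟩).2
  let w : Fin k → ∀ x, V x := fun i x => J x (v i x)
  have hvx₀ : ∀ i, v i x₀ = v₀ i := fun i => e.symm_apply_apply_mk hx₀ (v₀ i)
  have hv : ∀ i, SmoothSectionOn IB FV (v i) e.baseSet := by
    intro i
    refine e.contMDiffOn_section_baseSet_iff.mpr ?_
    refine (contMDiffOn_const (c := (e ⟨x₀, v₀ i⟩).2)).congr fun y hy => ?_
    rw [e.apply_mk_symm hy]
  have hw : ∀ i, SmoothSectionOn IB FV (w i) e.baseSet := fun i => hs.smoothSectionOn (hv i)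
  have hA : ContinuousOn (frameMap e v w) e.baseSet := fun x hx =>
    (contMDiffAt_frameMap (IB := IB)
      (fun i => (e.contMDiffOn_section_baseSet_iff.mp (hv i)).contMDiffAt
        (e.open_baseSet.mem_nhds hx))
      (fun i => (e.contMDiffOn_section_baseSet_iff.mp (hw i)).contMDiffAt
        (e.open_baseSet.mem_nhds hx))).continuousAt.continuousWithinAt
  have hopen : IsOpen {A : (Fin k → ℝ) × (Fin k → ℝ) →L[ℝ] FV | A.IsInvertible} :=
    ContinuousLinearEquiv.isOpen
  refine ⟨e.baseSet ∩ frameMap e v w ⁻¹' {A | A.IsInvertible},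
    hA.isOpen_inter_preimage e.open_baseSet hopen, ⟨hx₀, ?_⟩, k, w, v,
    fun i => (hw i).mono inter_subset_left, fun i => (hv i).mono inter_subset_left, ?_⟩
  · refine (frameMap_isInvertible_iff e v w hx₀).mpr ?_
    simpa only [w, hvx₀] using hv₀
  · rintro x ⟨hx, hinv⟩
    exact (basis_eigenspace_iff (hJ x) (fun i => v i x) (fun i => w i x) fun _ => rfl).mpr
      ((frameMap_isInvertible_iff e v w hx).mp hinv)

/-- A complex structure whose `i`-eigenbundle is a smooth complex subbundle is smooth. -/
theorem smoothEndomorphism_of_isComplexSubbundle [FiniteDimensional ℝ FV]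
    {J : ∀ x, V x →ₗ[ℝ] V x} (hJ : ∀ x v, J x (J x v) = -v)
    (hD : IsComplexSubbundle IB FV fun x =>
      Module.End.eigenspace ((J x).baseChange ℂ) Complex.I) :
    SmoothEndomorphism IB FV J := by
  intro p₀
  obtain ⟨N, hN, hxN, k, w, v, hw, hv, hbasis⟩ := hD p₀.1
  let e := trivializationAt FV V p₀.1
  have hx₀ : p₀.1 ∈ e.baseSet := mem_baseSet_trivializationAt FV V p₀.1
  have hwv : ∀ x ∈ N, ∀ i, w i x = J x (v i x) := by
    intro x hx i
    refine (cx_mem_eigenspace_I (hJ x)).mp ?_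
    exact (hbasis x hx).2.le (Submodule.subset_span ⟨i, rfl⟩)
  have hbij : ∀ x ∈ N, Function.Bijective
      (fun p : (Fin k → ℝ) × (Fin k → ℝ) => ∑ i, p.1 i • v i x + ∑ i, p.2 i • w i x) :=
    fun x hx => (basis_eigenspace_iff (hJ x) _ _ (hwv x hx)).mp (hbasis x hx)
  have hv' : ∀ i, ContMDiffAt IB 𝓘(ℝ, FV) ∞ (fun x => (e ⟨x, v i x⟩).2) p₀.1 := fun i =>
    (contMDiffAt_section _).mp ((hv i).contMDiffAt (hN.mem_nhds hxN))
  have hw' : ∀ i, ContMDiffAt IB 𝓘(ℝ, FV) ∞ (fun x => (e ⟨x, w i x⟩).2) p₀.1 := fun i =>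
    (contMDiffAt_section _).mp ((hw i).contMDiffAt (hN.mem_nhds hxN))
  have hinv := (frameMap_isInvertible_iff e v w hx₀).mpr (hbij _ hxN)
  -- In the frame `(v, w)` with `w = Jv`, the map `J` has the constant matrix `(s, t) ↦ (-t, s)`. So
  -- locally `J = A σ A⁻¹`, where `A` is the smooth invertible `frameMap`.
  let σ : (Fin k → ℝ) × (Fin k → ℝ) →L[ℝ] (Fin k → ℝ) × (Fin k → ℝ) :=
    (-ContinuousLinearMap.snd ℝ (Fin k → ℝ) (Fin k → ℝ)).prod
      (ContinuousLinearMap.fst ℝ (Fin k → ℝ) (Fin k → ℝ))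
  have hproj : ContMDiffAt (IB.prod 𝓘(ℝ, FV)) IB ∞ (fun p : TotalSpace FV V => p.1) p₀ :=
    contMDiffAt_proj V
  have hsnd : ContMDiffAt (IB.prod 𝓘(ℝ, FV)) 𝓘(ℝ, FV) ∞
      (fun p : TotalSpace FV V => (e p).2) p₀ :=
    (contMDiffAt_totalSpace.mp (contMDiffAt_id (x := p₀))).2
  have hA := (contMDiffAt_frameMap (IB := IB) hv' hw').comp p₀ hproj
  have hAinv : ContMDiffAt (IB.prod 𝓘(ℝ, FV)) 𝓘(ℝ, FV →L[ℝ] (Fin k → ℝ) × (Fin k → ℝ)) ∞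
      (fun p : TotalSpace FV V => (frameMap e v w p.1).inverse) p₀ :=
    ContMDiffAt.comp p₀ (hinv.contDiffAt_map_inverse.contMDiffAt) hA
  refine contMDiffAt_totalSpace.mpr ⟨hproj, ?_⟩
  have hcomp : ContMDiffAt (IB.prod 𝓘(ℝ, FV)) 𝓘(ℝ, FV) ∞
      (fun p : TotalSpace FV V =>
        frameMap e v w p.1 (σ ((frameMap e v w p.1).inverse (e p).2))) p₀ :=
    hA.clm_apply ((ContinuousLinearMap.contMDiff (L := σ)).contMDiffAt.comp p₀
      (hAinv.clm_apply hsnd))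
  refine hcomp.congr_of_eventuallyEq ?_
  have hU : (TotalSpace.proj : TotalSpace FV V → B) ⁻¹' (N ∩ e.baseSet) ∈ 𝓝 p₀ :=
    hproj.continuousAt.preimage_mem_nhds
      ((hN.inter e.open_baseSet).mem_nhds ⟨hxN, hx₀⟩)
  filter_upwards [hU] with p hp
  obtain ⟨x, y⟩ := p
  obtain ⟨hpN, hpe⟩ : x ∈ N ∧ x ∈ e.baseSet := hp
  obtain ⟨q, rfl⟩ := (hbij x hpN).2 y
  have hq : (e ⟨x, ∑ i, q.1 i • v i x + ∑ i, q.2 i • w i x⟩).2 = frameMap e v w x q :=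
    (frameMap_apply e v w hpe q).symm
  change (e ⟨x, J x (∑ i, q.1 i • v i x + ∑ i, q.2 i • w i x)⟩).2 =
    frameMap e v w x (σ ((frameMap e v w x).inverse
      (e ⟨x, ∑ i, q.1 i • v i x + ∑ i, q.2 i • w i x⟩).2))
  obtain ⟨A, hA⟩ := (frameMap_isInvertible_iff e v w hpe).mpr (hbij x hpN)
  rw [hq, ← hA, ContinuousLinearMap.inverse_equiv]
  simp only [ContinuousLinearEquiv.coe_coe, ContinuousLinearEquiv.symm_apply_apply]
  rw [← ContinuousLinearEquiv.coe_coe A, hA, frameMap_apply e v w hpe]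
  change e.continuousLinearEquivAt ℝ x hpe _ = _
  congr 1
  simp only [map_add, map_sum, map_smul, ← hwv x hpN, σ, ContinuousLinearMap.prod_apply,
    neg_apply, ContinuousLinearMap.coe_fst', ContinuousLinearMap.coe_snd',
    Pi.neg_apply, neg_smul, Finset.sum_neg_distrib]
  have : ∀ i, J x (w i x) = -v i x := fun i => by rw [hwv x hpN, hJ]
  simp only [this, smul_neg, Finset.sum_neg_distrib]
  abel

end Frames

/-! ### The structure maps of `TE` in preferred charts -/

section Derivatives

variable {EM : Type*} [NormedAddCommGroup EM] [NormedSpace ℝ EM]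
  {H : Type*} [TopologicalSpace H] {I : ModelWithCorners ℝ EM H}
  {M : Type*} [TopologicalSpace M] [ChartedSpace H M]

section FiberwiseMap

variable {F₁ F₂ : Type*} [NormedAddCommGroup F₁] [NormedSpace ℝ F₁] [NormedAddCommGroup F₂]
  [NormedSpace ℝ F₂] {E₁ E₂ : M → Type*}
  [TopologicalSpace (TotalSpace F₁ E₁)] [∀ x, TopologicalSpace (E₁ x)] [FiberBundle F₁ E₁]
  [TopologicalSpace (TotalSpace F₂ E₂)] [∀ x, TopologicalSpace (E₂ x)] [FiberBundle F₂ E₂]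

/-- The derivative of a bundle map over the identity which is a constant linear map `T` in the
preferred trivializations. -/
theorem hasMFDerivAt_fiberwise (g : ∀ z : TotalSpace F₁ E₁, E₂ z.1) (z₀ : TotalSpace F₁ E₁)
    (T : F₁ →L[ℝ] F₂)
    (hT : ∀ z : TotalSpace F₁ E₁, z.1 ∈ (trivializationAt F₁ E₁ z₀.1).baseSet →
      (trivializationAt F₂ E₂ z₀.1 ⟨z.1, g z⟩).2 = T (trivializationAt F₁ E₁ z₀.1 z).2)
    (hb : (trivializationAt F₁ E₁ z₀.1).baseSet ⊆ (trivializationAt F₂ E₂ z₀.1).baseSet) :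
    HasMFDerivAt (I.prod 𝓘(ℝ, F₁)) (I.prod 𝓘(ℝ, F₂))
      (fun z : TotalSpace F₁ E₁ => (⟨z.1, g z⟩ : TotalSpace F₂ E₂)) z₀
      ((ContinuousLinearMap.id ℝ EM).prodMap T : EM × F₁ →L[ℝ] EM × F₂) := by
  have hproj : ContMDiffAt (I.prod 𝓘(ℝ, F₁)) I 0 (fun z : TotalSpace F₁ E₁ => z.1) z₀ :=
    contMDiffAt_proj E₁
  have hsnd := (contMDiffAt_totalSpace.mp
    (contMDiffAt_id (x := z₀) (I := I.prod 𝓘(ℝ, F₁)) (n := 0))).2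
  have hU : (TotalSpace.proj : TotalSpace F₁ E₁ → M) ⁻¹' (trivializationAt F₁ E₁ z₀.1).baseSet
      ∈ 𝓝 z₀ :=
    hproj.continuousAt.preimage_mem_nhds ((trivializationAt F₁ E₁ z₀.1).open_baseSet.mem_nhds
      (mem_baseSet_trivializationAt F₁ E₁ z₀.1))
  constructor
  · refine ContMDiffAt.continuousAt (I := I.prod 𝓘(ℝ, F₁)) (I' := I.prod 𝓘(ℝ, F₂)) (n := 0) ?_
    refine contMDiffAt_totalSpace.mpr ⟨hproj, ?_⟩
    refine ((ContinuousLinearMap.contMDiff (L := T)).contMDiffAt.comp z₀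
      hsnd).congr_of_eventuallyEq ?_
    filter_upwards [hU] with z hz using hT z hz
  · suffices hev : writtenInExtChartAt (I.prod 𝓘(ℝ, F₁)) (I.prod 𝓘(ℝ, F₂)) z₀
        (fun z : TotalSpace F₁ E₁ => (⟨z.1, g z⟩ : TotalSpace F₂ E₂))
        =ᶠ[𝓝[range (I.prod 𝓘(ℝ, F₁))] (extChartAt (I.prod 𝓘(ℝ, F₁)) z₀ z₀)]
          ((ContinuousLinearMap.id ℝ EM).prodMap T : EM × F₁ →L[ℝ] EM × F₂) from
      HasFDerivWithinAt.congr_of_eventuallyEq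
        ((ContinuousLinearMap.id ℝ EM).prodMap T).hasFDerivWithinAt hev
        (hev.self_of_nhdsWithin (mem_range_self _))
    filter_upwards [extChartAt_target_mem_nhdsWithin (I := I.prod 𝓘(ℝ, F₁)) z₀] with y hy
    obtain ⟨z, hz, rfl⟩ : ∃ z ∈ (extChartAt (I.prod 𝓘(ℝ, F₁)) z₀).source,
        extChartAt (I.prod 𝓘(ℝ, F₁)) z₀ z = y :=
      ⟨_, (extChartAt (I.prod 𝓘(ℝ, F₁)) z₀).map_target hy,
        (extChartAt (I.prod 𝓘(ℝ, F₁)) z₀).right_inv hy⟩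
    rw [writtenInExtChartAt, Function.comp_apply, Function.comp_apply,
      (extChartAt (I.prod 𝓘(ℝ, F₁)) z₀).left_inv hz]
    rw [FiberBundle.extChartAt, PartialEquiv.trans_source] at hz
    have hz' : z.1 ∈ (trivializationAt F₁ E₁ z₀.1).baseSet :=
      (trivializationAt F₁ E₁ z₀.1).mem_source.mp hz.1
    rw [FiberBundle.extChartAt, FiberBundle.extChartAt]
    refine Prod.ext ?_ (hT z hz')
    change extChartAt I z₀.1 (trivializationAt F₂ E₂ z₀.1 ⟨z.1, g z⟩).1
      = extChartAt I z₀.1 (trivializationAt F₁ E₁ z₀.1 z).1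
    rw [(trivializationAt F₁ E₁ z₀.1).coe_fst' hz',
      (trivializationAt F₂ E₂ z₀.1).coe_fst' (hb hz')]

end FiberwiseMap

variable {F : Type*} [NormedAddCommGroup F] [NormedSpace ℝ F]
  {E : M → Type*} [TopologicalSpace (TotalSpace F E)] [∀ x, TopologicalSpace (E x)] [FiberBundle F E]

/-- In the preferred charts the bundle projection reads `(x, f) ↦ x`, and a linear map is its own
derivative. -/
theorem Tq_eq (p : TotalSpace F E) : Tq I F E p = ContinuousLinearMap.fst ℝ EM F := by
  refine HasMFDerivAt.mfderiv ⟨(contMDiffAt_proj (IB := I) (n := 0) E).continuousAt, ?_⟩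
  suffices hev : writtenInExtChartAt (I.prod 𝓘(ℝ, F)) I p (TotalSpace.proj : TotalSpace F E → M)
      =ᶠ[𝓝[range (I.prod 𝓘(ℝ, F))] (extChartAt (I.prod 𝓘(ℝ, F)) p p)]
        (ContinuousLinearMap.fst ℝ EM F) from
    HasFDerivWithinAt.congr_of_eventuallyEq (ContinuousLinearMap.fst ℝ EM F).hasFDerivWithinAt hev
      (hev.self_of_nhdsWithin (mem_range_self _))
  filter_upwards [extChartAt_target_mem_nhdsWithin (I := I.prod 𝓘(ℝ, F)) p] with y hy
  obtain ⟨z, hz, rfl⟩ : ∃ z ∈ (extChartAt (I.prod 𝓘(ℝ, F)) p).source,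
      extChartAt (I.prod 𝓘(ℝ, F)) p z = y :=
    ⟨_, (extChartAt (I.prod 𝓘(ℝ, F)) p).map_target hy,
      (extChartAt (I.prod 𝓘(ℝ, F)) p).right_inv hy⟩
  rw [writtenInExtChartAt, Function.comp_apply, Function.comp_apply,
    (extChartAt (I.prod 𝓘(ℝ, F)) p).left_inv hz]
  rw [FiberBundle.extChartAt, PartialEquiv.trans_source] at hz
  rw [FiberBundle.extChartAt]
  change extChartAt I p.1 z.1 = extChartAt I p.1 (trivializationAt F E p.1 z).1
  rw [(trivializationAt F E p.1).coe_fst hz.1]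

theorem Tq_apply (p : TotalSpace F E) (u : EM × F) : Tq I F E p u = u.1 := by
  rw [Tq_eq]; rfl

variable [∀ x, AddCommGroup (E x)]

theorem Tfst_eq {m : M} (e e' : E m) : Tfst I F e e' = (ContinuousLinearMap.id ℝ EM).prodMap
    (ContinuousLinearMap.fst ℝ F F) :=
  (hasMFDerivAt_fiberwise (fun z : TotalSpace (F × F) (E ×ᵇ E) => z.2.1)
    (TotalSpace.mk' (F × F) (E := E ×ᵇ E) m (e, e')) (ContinuousLinearMap.fst ℝ F F)
    (fun _ _ => rfl) inter_subset_left).mfderiv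

theorem Tsnd_eq {m : M} (e e' : E m) : Tsnd I F e e' = (ContinuousLinearMap.id ℝ EM).prodMap
    (ContinuousLinearMap.snd ℝ F F) :=
  (hasMFDerivAt_fiberwise (fun z : TotalSpace (F × F) (E ×ᵇ E) => z.2.2)
    (TotalSpace.mk' (F × F) (E := E ×ᵇ E) m (e, e')) (ContinuousLinearMap.snd ℝ F F)
    (fun _ _ => rfl) inter_subset_left).mfderiv

variable [∀ x, Module ℝ (E x)] [VectorBundle ℝ F E]

/-- The preferred trivialization of `E`, on the fibre over its centre. -/
def fiberEquiv (F : Type*) [NormedAddCommGroup F] [NormedSpace ℝ F]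
    (E : M → Type*) [∀ x, AddCommGroup (E x)] [∀ x, Module ℝ (E x)]
    [TopologicalSpace (TotalSpace F E)] [∀ x, TopologicalSpace (E x)]
    [FiberBundle F E] [VectorBundle ℝ F E] (m : M) : E m ≃L[ℝ] F :=
  (trivializationAt F E m).continuousLinearEquivAt ℝ m (mem_baseSet_trivializationAt F E m)

/-- Read in the chart at `p`, the inclusion of the fibre has constant base coordinate and is a
translation in the fibre coordinate. -/
theorem verticalLift_eq (p : TotalSpace F E) :
    verticalLift I F E p
      = (ContinuousLinearMap.inr ℝ EM F).comp (fiberEquiv F E p.1 : E p.1 →L[ℝ] F) := by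
  have key : HasMFDerivAt 𝓘(ℝ, F) (I.prod 𝓘(ℝ, F))
      (fun f : F => TotalSpace.mk' F p.1 (p.2 + (fiberEquiv F E p.1).symm f)) 0
      (ContinuousLinearMap.inr ℝ EM F) := by
    have hcoord : ∀ f : F,
        (trivializationAt F E p.1 ⟨p.1, p.2 + (fiberEquiv F E p.1).symm f⟩).2
          = fiberEquiv F E p.1 p.2 + f := by
      intro f
      change fiberEquiv F E p.1 (p.2 + (fiberEquiv F E p.1).symm f) = _
      rw [map_add, ContinuousLinearEquiv.apply_symm_apply]
    constructor
    · refine ContMDiffAt.continuousAt (I := 𝓘(ℝ, F)) (I' := I.prod 𝓘(ℝ, F)) (n := 0) ?_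
      refine contMDiffAt_totalSpace.mpr ⟨contMDiffAt_const, ?_⟩
      exact ContMDiffAt.congr_of_eventuallyEq (contMDiffAt_const.add contMDiffAt_id)
        (Filter.Eventually.of_forall hcoord)
    · have : HasFDerivWithinAt
          (fun f : F => (extChartAt I p.1 p.1, fiberEquiv F E p.1 p.2 + f))
          (ContinuousLinearMap.inr ℝ EM F) (range 𝓘(ℝ, F)) (extChartAt 𝓘(ℝ, F) (0 : F) 0) :=
        ((hasFDerivAt_const _ _).prodMk
          ((hasFDerivAt_id _).const_add (fiberEquiv F E p.1 p.2))).hasFDerivWithinAt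
      suffices hev : ∀ f : F, writtenInExtChartAt 𝓘(ℝ, F) (I.prod 𝓘(ℝ, F)) 0
          (fun f : F => TotalSpace.mk' F p.1 (p.2 + (fiberEquiv F E p.1).symm f)) f
          = (extChartAt I p.1 p.1, fiberEquiv F E p.1 p.2 + f) from
        HasFDerivWithinAt.congr_of_eventuallyEq this (Filter.Eventually.of_forall hev) (hev _)
      intro f
      rw [writtenInExtChartAt, FiberBundle.extChartAt]
      refine Prod.ext ?_ (hcoord f)
      change extChartAt I p.1 (trivializationAt F E p.1 ⟨p.1, _⟩).1 = _
      exact congrArg (extChartAt I p.1) ((trivializationAt F E p.1).coe_fst'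
        (x := ⟨p.1, p.2 + (fiberEquiv F E p.1).symm f⟩) (mem_baseSet_trivializationAt F E p.1))
  change ContinuousLinearMap.comp (mfderiv 𝓘(ℝ, F) (I.prod 𝓘(ℝ, F))
      (fun f : F => TotalSpace.mk' F p.1 (p.2 + (fiberEquiv F E p.1).symm f)) 0)
      (fiberEquiv F E p.1 : E p.1 →L[ℝ] F) = _
  rw [key.mfderiv]
  rfl

variable {m : M} (e e' : E m)

theorem Tadd_eq : Tadd I F e e' = (ContinuousLinearMap.id ℝ EM).prodMap
    (ContinuousLinearMap.fst ℝ F F + ContinuousLinearMap.snd ℝ F F) :=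
  (hasMFDerivAt_fiberwise (fun z : TotalSpace (F × F) (E ×ᵇ E) => z.2.1 + z.2.2)
    (TotalSpace.mk' (F × F) (E := E ×ᵇ E) m (e, e'))
    (ContinuousLinearMap.fst ℝ F F + ContinuousLinearMap.snd ℝ F F)
    (fun z hz => ((trivializationAt F E m).linear ℝ (mem_of_mem_inter_left hz)).map_add z.2.1 z.2.2)
    inter_subset_left).mfderiv

theorem Tsmul_eq (r : ℝ) : Tsmul I F e r = (ContinuousLinearMap.id ℝ EM).prodMap
    (r • ContinuousLinearMap.id ℝ F) :=
  (hasMFDerivAt_fiberwise (fun z : TotalSpace F E => r • z.2) (TotalSpace.mk' F m e)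
    (r • ContinuousLinearMap.id ℝ F)
    (fun z hz => ((trivializationAt F E m).linear ℝ hz).map_smul r z.2) subset_rfl).mfderiv

end Derivatives

/-! ### Addition and scalar multiplication in `𝕋E → TM ⊕ E*` -/

section SideStructure

variable {EM : Type*} [NormedAddCommGroup EM] [NormedSpace ℝ EM]
  {H : Type*} [TopologicalSpace H] {I : ModelWithCorners ℝ EM H}
  {M : Type*} [TopologicalSpace M] [ChartedSpace H M]
  {F : Type*} [NormedAddCommGroup F] [NormedSpace ℝ F]
  {E : M → Type*} [TopologicalSpace (TotalSpace F E)] [∀ x, TopologicalSpace (E x)] [FiberBundle F E]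

/-- The tangent component of an element of `𝕋E`, in the preferred chart. -/
def tangentCoord {p : TotalSpace F E} (ξ : GenTE I F E p) : EM × F := ξ.1

/-- The cotangent component of an element of `𝕋E`, in the preferred chart. -/
def cotangentCoord {p : TotalSpace F E} (ξ : GenTE I F E p) : EM × F →L[ℝ] ℝ := ξ.2

variable [∀ x, AddCommGroup (E x)]

theorem IsSideAdd.neg {m : M} {e e' : E m} {ξ : GenTE I F E ⟨m, e⟩}
    {η : GenTE I F E ⟨m, e'⟩} {ζ : GenTE I F E ⟨m, e + e'⟩}
    (h : IsSideAdd I F ξ η ζ) : IsSideAdd I F (-ξ) (-η) (-ζ) := by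
  obtain ⟨⟨z, h₁, h₂, h₃⟩, h₄⟩ := h
  refine ⟨⟨-z, by rw [map_neg, h₁]; rfl, by rw [map_neg, h₂]; rfl, by rw [map_neg, h₃]; rfl⟩,
    fun z => ?_⟩
  have := congrArg (fun r : ℝ => -r) (h₄ z)
  exact this.trans (neg_add _ _)

variable [∀ x, Module ℝ (E x)] [VectorBundle ℝ F E]

theorem rE_eq (p : TotalSpace F E) (α : EM × F →L[ℝ] ℝ) :
    rE I F E p α = (α.comp (ContinuousLinearMap.inr ℝ EM F)).comp
      (fiberEquiv F E p.1 : E p.1 →L[ℝ] F) := by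
  change α.comp (verticalLift I F E p) = _
  rw [verticalLift_eq]
  rfl

theorem rE_eq_iff {m : M} {e e' : E m} {ξ : GenTE I F E ⟨m, e⟩} {η : GenTE I F E ⟨m, e'⟩} :
    rE I F E ⟨m, e⟩ ξ.2 = rE I F E ⟨m, e'⟩ η.2 ↔
      ∀ f : F, cotangentCoord ξ (0, f) = cotangentCoord η (0, f) := by
  have h₁ : rE I F E ⟨m, e⟩ ξ.2 = ((cotangentCoord ξ).comp (ContinuousLinearMap.inr ℝ EM F)).comp
      (fiberEquiv F E m : E m →L[ℝ] F) := rE_eq ⟨m, e⟩ ξ.2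
  have h₂ : rE I F E ⟨m, e'⟩ η.2 = ((cotangentCoord η).comp (ContinuousLinearMap.inr ℝ EM F)).comp
      (fiberEquiv F E m : E m →L[ℝ] F) := rE_eq ⟨m, e'⟩ η.2
  rw [h₁, h₂]
  constructor
  · intro h f
    have : cotangentCoord ξ (0, fiberEquiv F E m ((fiberEquiv F E m).symm f))
        = cotangentCoord η (0, fiberEquiv F E m ((fiberEquiv F E m).symm f)) :=
      DFunLike.congr_fun h ((fiberEquiv F E m).symm f)
    rwa [ContinuousLinearEquiv.apply_symm_apply] at this
  · exact fun h => ContinuousLinearMap.ext fun f => h (fiberEquiv F E m f)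

theorem sideProj_eq_iff {m : M} {e e' : E m} {ξ : GenTE I F E ⟨m, e⟩}
    {η : GenTE I F E ⟨m, e'⟩} :
    sideProj I F E ⟨m, e⟩ ξ = sideProj I F E ⟨m, e'⟩ η ↔
      (tangentCoord ξ).1 = (tangentCoord η).1 ∧
      ∀ f : F, cotangentCoord ξ (0, f) = cotangentCoord η (0, f) := by
  rw [← rE_eq_iff, Prod.ext_iff]
  refine and_congr ?_ Iff.rfl
  have h₁ : Tq I F E ⟨m, e⟩ ξ.1 = (tangentCoord ξ).1 := Tq_apply _ _
  have h₂ : Tq I F E ⟨m, e'⟩ η.1 = (tangentCoord η).1 := Tq_apply _ _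
  exact ⟨fun h => h₁.symm.trans (h.trans h₂), fun h => h₁.trans (h.trans h₂.symm)⟩

theorem sideProj_surjective (p : TotalSpace F E) : Function.Surjective (sideProj I F E p) := by
  rintro ⟨u, φ⟩
  let φ' : E p.1 →L[ℝ] ℝ := φ
  let α : EM × F →L[ℝ] ℝ := (φ'.comp
    ((fiberEquiv F E p.1).symm : F →L[ℝ] E p.1)).comp (ContinuousLinearMap.snd ℝ EM F)
  refine ⟨(((u, 0) : EM × F), α), Prod.ext (Tq_apply p _) ((rE_eq p α).trans ?_)⟩
  refine ContinuousLinearMap.ext fun f => ?_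
  exact congrArg φ' ((fiberEquiv F E p.1).symm_apply_apply f)

theorem isSideAdd_iff {m : M} {e e' : E m} {ξ : GenTE I F E ⟨m, e⟩}
    {η : GenTE I F E ⟨m, e'⟩} {ζ : GenTE I F E ⟨m, e + e'⟩} :
    IsSideAdd I F ξ η ζ ↔
      (∃ (u : EM) (f f' : F), (u, f) = tangentCoord ξ ∧
        (u, f') = tangentCoord η ∧ (u, f + f') = tangentCoord ζ) ∧
      ∀ (u : EM) (f f' : F), cotangentCoord ζ (u, f + f')
        = cotangentCoord ξ (u, f) + cotangentCoord η (u, f') := by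
  rw [IsSideAdd, Tfst_eq, Tsnd_eq, Tadd_eq]
  constructor
  · rintro ⟨⟨⟨u, f, f'⟩, h⟩, h'⟩
    exact ⟨⟨u, f, f', h⟩, fun u f f' => h' (u, f, f')⟩
  · rintro ⟨⟨u, f, f', h⟩, h'⟩
    exact ⟨⟨(u, f, f'), h⟩, fun ⟨u, f, f'⟩ => h' u f f'⟩

/-- The covector is determined because the derivative of the addition is onto: in coordinates `(w,
a)` is the image of `(w, a, 0)`. -/
theorem IsSideAdd.unique {m : M} {e e' : E m} {ξ : GenTE I F E ⟨m, e⟩}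
    {η : GenTE I F E ⟨m, e'⟩} {ζ ζ' : GenTE I F E ⟨m, e + e'⟩}
    (h : IsSideAdd I F ξ η ζ) (h' : IsSideAdd I F ξ η ζ') : ζ = ζ' := by
  rw [isSideAdd_iff] at h h'
  obtain ⟨⟨u, f, f', h₁, h₂, h₃⟩, h₄⟩ := h
  obtain ⟨⟨v, g, g', h₁', h₂', h₃'⟩, h₄'⟩ := h'
  refine Prod.ext ?_ ?_
  · have hu := h₁.trans h₁'.symm
    have hv := h₂.trans h₂'.symm
    rw [Prod.mk_inj] at hu hv
    refine h₃.symm.trans (Eq.trans ?_ h₃')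
    rw [hu.1, hu.2, hv.2]
  · refine ContinuousLinearMap.ext fun (w : EM × F) => ?_
    have := (h₄ w.1 w.2 0).trans (h₄' w.1 w.2 0).symm
    rwa [add_zero] at this

theorem IsSideAdd.sideProj_eq {m : M} {e e' : E m} {ξ : GenTE I F E ⟨m, e⟩}
    {η : GenTE I F E ⟨m, e'⟩} {ζ : GenTE I F E ⟨m, e + e'⟩} (h : IsSideAdd I F ξ η ζ) :
    sideProj I F E ⟨m, e⟩ ξ = sideProj I F E ⟨m, e'⟩ η := by
  rw [isSideAdd_iff] at h
  obtain ⟨⟨u, f, f', h₁, h₂, -⟩, h₄⟩ := h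
  rw [sideProj_eq_iff, ← h₁, ← h₂]
  refine ⟨rfl, fun g => ?_⟩
  -- A vertical vector `g` can be put in either summand; comparing the two shows that both covectors
  -- agree on it.
  have h₅ := h₄ 0 g 0
  have h₆ := h₄ 0 0 g
  rw [add_zero, ← Prod.zero_eq_mk, map_zero, add_zero] at h₅
  rw [zero_add, ← Prod.zero_eq_mk, map_zero, zero_add] at h₆
  exact h₅.symm.trans h₆

theorem exists_isSideAdd {m : M} {e e' : E m} {ξ : GenTE I F E ⟨m, e⟩}
    {η : GenTE I F E ⟨m, e'⟩} (h : sideProj I F E ⟨m, e⟩ ξ = sideProj I F E ⟨m, e'⟩ η) :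
    ∃ ζ : GenTE I F E ⟨m, e + e'⟩, IsSideAdd I F ξ η ζ := by
  rw [sideProj_eq_iff] at h
  obtain ⟨h₁, h₂⟩ := h
  obtain ⟨⟨u, f⟩, α⟩ := ξ
  obtain ⟨⟨v, g⟩, β⟩ := η
  change u = v at h₁
  subst h₁
  change EM × F →L[ℝ] ℝ at α β
  change ∀ f : F, α (0, f) = β (0, f) at h₂
  -- The sum covector is `α(w, c) + β(w, 0)`. It satisfies the addition rule because `α` and `β`
  -- agree on vertical vectors.
  refine ⟨(((u, f + g) : EM × F), (α + β.comp ((ContinuousLinearMap.inl ℝ EM F).comp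
    (ContinuousLinearMap.fst ℝ EM F)) : EM × F →L[ℝ] ℝ)), isSideAdd_iff.mpr
      ⟨⟨u, f, g, rfl, rfl, rfl⟩, fun w a b => ?_⟩⟩
  change α (w, a + b) + β (w, 0) = α (w, a) + β (w, b)
  have h₃ : α (w, a + b) = α (w, a) + α (0, b) := by rw [← map_add, Prod.mk_add_mk, add_zero]
  have h₄ : β (w, b) = β (w, 0) + β (0, b) := by
    rw [← map_add, Prod.mk_add_mk, add_zero, zero_add]
  rw [h₃, h₄, h₂]
  ring

theorem isSideSMul_iff {m : M} {e : E m} {r : ℝ} {ξ : GenTE I F E ⟨m, e⟩}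
    {ζ : GenTE I F E ⟨m, r • e⟩} :
    IsSideSMul I F r ξ ζ ↔
      (tangentCoord ζ)
        = ((tangentCoord ξ).1, r • (tangentCoord ξ).2) ∧
      (∀ (u : EM) (f : F), cotangentCoord ζ (u, r • f)
        = r * cotangentCoord ξ (u, f)) ∧
      ∀ f : F, cotangentCoord ζ (0, f) = cotangentCoord ξ (0, f) := by
  rw [IsSideSMul, Tsmul_eq]
  exact and_congr Iff.rfl (and_congr ⟨fun h u f => h (u, f), fun h u => h u.1 u.2⟩ rE_eq_iff)

theorem IsSideSMul.unique {m : M} {e : E m} {r : ℝ} {ξ : GenTE I F E ⟨m, e⟩}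
    {ζ ζ' : GenTE I F E ⟨m, r • e⟩} (h : IsSideSMul I F r ξ ζ) (h' : IsSideSMul I F r ξ ζ') :
    ζ = ζ' := by
  rw [isSideSMul_iff] at h h'
  refine Prod.ext (h.1.trans h'.1.symm) ?_
  refine ContinuousLinearMap.ext fun (w : EM × F) => ?_
  have h₁ := (h.2.1 w.1 0).trans (h'.2.1 w.1 0).symm
  have h₂ := (h.2.2 w.2).trans (h'.2.2 w.2).symm
  rw [smul_zero] at h₁
  have hw : w = (w.1, 0) + (0, w.2) := by simp
  change cotangentCoord ζ w = cotangentCoord ζ' w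
  rw [hw, map_add, map_add, h₁, h₂]

theorem IsSideSMul.neg {m : M} {e : E m} {r : ℝ} {ξ : GenTE I F E ⟨m, e⟩}
    {ζ : GenTE I F E ⟨m, r • e⟩} (h : IsSideSMul I F r ξ ζ) : IsSideSMul I F r (-ξ) (-ζ) := by
  obtain ⟨h₁, h₂, h₃⟩ := h
  refine ⟨?_, fun u => ?_, ?_⟩
  · change -ζ.1 = Tsmul I F e r (-ξ.1)
    rw [map_neg, h₁]
  · have := congrArg (fun s : ℝ => -s) (h₂ u)
    exact this.trans (mul_neg _ _).symm
  · change rE I F E _ (-ζ.2) = rE I F E _ (-ξ.2)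
    rw [map_neg, map_neg, h₃]

theorem IsSideSMul.sideProj_eq {m : M} {e : E m} {r : ℝ} {ξ : GenTE I F E ⟨m, e⟩}
    {ζ : GenTE I F E ⟨m, r • e⟩} (h : IsSideSMul I F r ξ ζ) :
    sideProj I F E ⟨m, r • e⟩ ζ = sideProj I F E ⟨m, e⟩ ξ := by
  rw [isSideSMul_iff] at h
  rw [sideProj_eq_iff, h.1]
  exact ⟨rfl, h.2.2⟩

theorem exists_isSideSMul {m : M} {e : E m} (r : ℝ) (ξ : GenTE I F E ⟨m, e⟩) :
    ∃ ζ : GenTE I F E ⟨m, r • e⟩, IsSideSMul I F r ξ ζ := by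
  obtain ⟨⟨u, f⟩, α⟩ := ξ
  change EM × F →L[ℝ] ℝ at α
  -- The covector is scaled on the base directions and kept on the vertical ones, which also covers
  -- `r = 0`.
  refine ⟨(((u, r • f) : EM × F), (r • α.comp ((ContinuousLinearMap.inl ℝ EM F).comp
    (ContinuousLinearMap.fst ℝ EM F)) + α.comp ((ContinuousLinearMap.inr ℝ EM F).comp
    (ContinuousLinearMap.snd ℝ EM F)) : EM × F →L[ℝ] ℝ)), isSideSMul_iff.mpr
      ⟨rfl, fun w a => ?_, fun a => ?_⟩⟩
  · change r * α (w, 0) + α (0, r • a) = r * α (w, a)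
    have h₁ : ((0, r • a) : EM × F) = r • (0, a) := by simp
    have h₂ : ((w, a) : EM × F) = (w, 0) + (0, a) := by simp
    rw [h₁, map_smul, h₂, map_add, mul_add, smul_eq_mul]
  · change r * α (0, 0) + α (0, a) = α (0, a)
    rw [← Prod.zero_eq_mk, map_zero, mul_zero, zero_add]

/-- The `0`-multiple of an element of `𝕋E → TM ⊕ E*` depends only on its projection. -/
theorem IsSideSMul.eq_of_sideProj_eq {m : M} {e : E m} {ξ ξ' : GenTE I F E ⟨m, e⟩}
    {ζ ζ' : GenTE I F E ⟨m, (0 : ℝ) • e⟩} (h : IsSideSMul I F 0 ξ ζ) (h' : IsSideSMul I F 0 ξ' ζ')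
    (hs : sideProj I F E ⟨m, e⟩ ξ = sideProj I F E ⟨m, e⟩ ξ') : ζ = ζ' := by
  refine IsSideSMul.unique h ?_
  rw [isSideSMul_iff] at h' ⊢
  rw [sideProj_eq_iff] at hs
  refine ⟨?_, fun u f => ?_, fun f => (h'.2.2 f).trans (hs.2 f).symm⟩
  · rw [h'.1, hs.1, zero_smul, zero_smul]
  · rw [h'.2.1 u f, zero_mul, zero_mul]

end SideStructure

/-! ### Nondegeneracy of the pairing -/

section Pairing

variable {EN : Type*} [NormedAddCommGroup EN] [NormedSpace ℝ EN]
  {HN : Type*} [TopologicalSpace HN] (IN : ModelWithCorners ℝ EN HN)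
  {N : Type*} [TopologicalSpace N] [ChartedSpace HN N]

theorem pairing_nondegenerate [FiniteDimensional ℝ EN] (x : N) (ξ : GenTangent IN x)
    (h : ∀ η, pairing IN x ξ η = 0) : ξ = 0 := by
  have h₁ : ∀ (v : EN) (β : EN →L[ℝ] ℝ),
      (show EN →L[ℝ] ℝ from ξ.2) v + β (show EN from ξ.1) = 0 := fun v β => h (v, β)
  refine Prod.ext ?_ ?_
  · change (show EN from ξ.1) = 0
    by_contra hne
    obtain ⟨β, hβ⟩ := SeparatingDual.exists_ne_zero (R := ℝ) hne
    have := h₁ 0 β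
    rw [map_zero, zero_add] at this
    exact hβ this
  · refine ContinuousLinearMap.ext fun v => ?_
    have := h₁ v 0
    rwa [zero_apply, add_zero] at this

end Pairing

/-! ### Generalised complex structures and complex Dirac structures -/

section Dirac

variable {EN : Type*} [NormedAddCommGroup EN] [NormedSpace ℝ EN]
  {HN : Type*} [TopologicalSpace HN] {IN : ModelWithCorners ℝ EN HN}
  {N : Type*} [TopologicalSpace N] [ChartedSpace HN N]

theorem contMDiffVectorBundle_tangentSpace [IsManifold IN ∞ N] :
    ContMDiffVectorBundle ∞ EN (TangentSpace IN : N → Type _) IN := by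
  have : IsManifold IN (∞ + 1) N := ‹IsManifold IN ∞ N›
  exact TangentBundle.contMDiffVectorBundle

theorem contMDiffVectorBundle_genTangent [IsManifold IN ∞ N] :
    ContMDiffVectorBundle ∞ (GenTangentModel EN) (GenTangent IN : N → Type _) IN := by
  have : ContMDiffVectorBundle ∞ EN (TangentSpace IN : N → Type _) IN :=
    contMDiffVectorBundle_tangentSpace
  infer_instance

variable [FiniteDimensional ℝ EN] [IsManifold IN 1 N]
  {𝒥 : ∀ x : N, GenTangent IN x →ₗ[ℝ] GenTangent IN x}

theorem IsGeneralisedComplex.isComplexDirac_I [IsManifold IN ∞ N]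
    (h : IsGeneralisedComplex IN 𝒥) :
    IsComplexDirac IN fun x => Module.End.eigenspace ((𝒥 x).baseChange ℂ) Complex.I where
  subbundle := by
    have : ContMDiffVectorBundle ∞ (GenTangentModel EN) (GenTangent IN : N → Type _) IN :=
      contMDiffVectorBundle_genTangent
    exact isComplexSubbundle_eigenspace h.smooth h.sq
  lagrangian x := eigenspace_lagrangian (pairing IN x) (pairing_nondegenerate IN x) (h.sq x)
    (h.orthogonal x)
  involutive a b c d _ hb _ hd hab hcd x := by
    obtain rfl : a = fun y => 𝒥 y (b y) :=
      funext fun y => (cx_mem_eigenspace_I (h.sq y)).mp (hab y)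
    obtain rfl : c = fun y => 𝒥 y (d y) :=
      funext fun y => (cx_mem_eigenspace_I (h.sq y)).mp (hcd y)
    refine (cx_mem_eigenspace_I (h.sq x)).mpr ?_
    -- Membership in the graph asks for `⟦𝒥b, 𝒥d⟧ - ⟦b, d⟧ = 𝒥(⟦𝒥b, d⟧ + ⟦b, 𝒥d⟧)`, the vanishing of
    -- the Nijenhuis tensor on the imaginary parts.
    rw [← sub_eq_zero, ← neg_eq_zero, ← h.nijenhuis b d hb hd x]
    abel

theorem IsGeneralisedComplex.isComplexDirac_neg_I [IsManifold IN ∞ N]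
    (h : IsGeneralisedComplex IN 𝒥) :
    IsComplexDirac IN fun x => Module.End.eigenspace ((𝒥 x).baseChange ℂ) (-Complex.I) where
  subbundle := by
    have : ContMDiffVectorBundle ∞ (GenTangentModel EN) (GenTangent IN : N → Type _) IN :=
      contMDiffVectorBundle_genTangent
    simp only [eigenspace_neg_I]
    exact isComplexSubbundle_eigenspace (h.smooth.neg h.sq) fun x v => by simp [h.sq]
  lagrangian x := by
    simp only [eigenspace_neg_I]
    exact eigenspace_lagrangian (pairing IN x) (pairing_nondegenerate IN x)
      (fun v => by simp [h.sq]) fun a b => by simp [h.orthogonal]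
  involutive a b c d ha _ hc _ hab hcd x := by
    have key : ∀ y (u v : GenTangent IN y), u = -𝒥 y v ↔ v = 𝒥 y u := by
      intro y u v
      constructor
      · rintro rfl
        rw [map_neg, h.sq, neg_neg]
      · rintro rfl
        rw [h.sq, neg_neg]
    -- Sections of the `-i`-eigenbundle have the form `a + i𝒥a`, so here the Nijenhuis identity is
    -- used on the real parts.
    obtain rfl : b = fun y => 𝒥 y (a y) :=
      funext fun y => (key y _ _).mp ((cx_mem_eigenspace_neg_I (h.sq y)).mp (hab y))
    obtain rfl : d = fun y => 𝒥 y (c y) :=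
      funext fun y => (key y _ _).mp ((cx_mem_eigenspace_neg_I (h.sq y)).mp (hcd y))
    refine (cx_mem_eigenspace_neg_I (h.sq x)).mpr ?_
    rw [← sub_eq_zero, ← h.nijenhuis a c ha hc x, add_comm (dorfman IN a _ x)]
    abel

/-- A complex structure on `𝕋N` whose `i`-eigenbundle is a complex Dirac structure is a
generalised complex structure. -/
theorem IsComplexDirac.isGeneralisedComplex (hJ : ∀ x v, 𝒥 x (𝒥 x v) = -v)
    (h : IsComplexDirac IN fun x => Module.End.eigenspace ((𝒥 x).baseChange ℂ) Complex.I) :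
    IsGeneralisedComplex IN 𝒥 := by
  have hs : SmoothEndomorphism IN (GenTangentModel EN) 𝒥 :=
    smoothEndomorphism_of_isComplexSubbundle hJ h.subbundle
  refine ⟨hs, hJ, fun x => ?_, fun ξ η hξ hη x => ?_⟩
  · exact (orthogonal_iff_isotropic (pairing IN x) (hJ x)).mpr fun y hy =>
      (h.lagrangian x y).mp hy
  -- Involutivity is tested on `𝒥ξ + iξ` and `𝒥η + iη`, which are smooth because `𝒥` is already
  -- known to be smooth.
  · have := h.involutive (fun y => 𝒥 y (ξ y)) ξ (fun y => 𝒥 y (η y)) η (hs.smoothSectionOn hξ) hξ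
      (hs.smoothSectionOn hη) hη (fun y => (cx_mem_eigenspace_I (hJ y)).mpr rfl)
      (fun y => (cx_mem_eigenspace_I (hJ y)).mpr rfl) x
    have := (cx_mem_eigenspace_I (hJ x)).mp this
    rw [← this]
    abel

end Dirac

/-! ### Linearity of `𝒥` versus sub-double vector bundles -/

section Linear

variable {EM : Type*} [NormedAddCommGroup EM] [NormedSpace ℝ EM]
  {H : Type*} [TopologicalSpace H] {I : ModelWithCorners ℝ EM H}
  {M : Type*} [TopologicalSpace M] [ChartedSpace H M]
  {F : Type*} [NormedAddCommGroup F] [NormedSpace ℝ F]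
  {E : M → Type*} [∀ x, AddCommGroup (E x)] [∀ x, Module ℝ (E x)]
  [TopologicalSpace (TotalSpace F E)] [∀ x, TopologicalSpace (E x)]
  [FiberBundle F E] [VectorBundle ℝ F E]
  [IsManifold I ∞ M] [ContMDiffVectorBundle ∞ F E I]

theorem contMDiffVectorBundle_side :
    ContMDiffVectorBundle ∞ (SideModel EM F) (Side I E) I := by
  have : ContMDiffVectorBundle ∞ EM (TangentSpace I : M → Type _) I :=
    contMDiffVectorBundle_tangentSpace
  infer_instance

variable {𝒥 : ∀ p : TotalSpace F E, GenTE I F E p →ₗ[ℝ] GenTE I F E p}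

theorem IsLinearEndomorphism.neg (hJ : ∀ p ξ, 𝒥 p (𝒥 p ξ) = -ξ)
    (h : IsLinearEndomorphism I F E 𝒥) : IsLinearEndomorphism I F E fun p => -𝒥 p where
  smooth := h.smooth.neg hJ
  side := by
    obtain ⟨j, hj, hΦ⟩ := h.side
    -- Since `-𝒥 = 𝒥³`, it covers `j³`, whose smoothness is immediate from composition.
    refine ⟨fun m => j m ∘ₗ (j m ∘ₗ j m), hj.comp (hj.comp hj), fun p ξ => ?_⟩
    have : (-𝒥 p) ξ = 𝒥 p (𝒥 p (𝒥 p ξ)) := (hJ p _).symm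
    rw [this, hΦ, hΦ, hΦ]
    rfl
  add m e e' ξ η ζ hs := (h.add m e e' ξ η ζ hs).neg
  smul r m e ξ ζ hs := (h.smul r m e ξ ζ hs).neg

/-- The side bundles of transverse and complex conjugate sub-double vector bundles are transverse
and complex conjugate. -/
theorem isCompl_side
    {D D' : ∀ p : TotalSpace F E, Submodule ℂ (ℂ ⊗[ℝ] GenTE I F E p)}
    {U U' : ∀ m : M, Submodule ℂ (ℂ ⊗[ℝ] Side I E m)}
    (hD : IsSubDoubleVectorBundle I F E D U) (hD' : IsSubDoubleVectorBundle I F E D' U')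
    (hc : ∀ p, IsCompl (D p) (D' p)) (m : M) : IsCompl (U m) (U' m) := by
  constructor
  · rw [Submodule.disjoint_def]
    intro u hu hu'
    rw [← hD.map_side ⟨m, 0⟩] at hu
    rw [← hD'.map_side ⟨m, 0⟩] at hu'
    obtain ⟨y, hy, rfl⟩ := hu
    obtain ⟨y', hy', hyy'⟩ := hu'
    obtain ⟨a, b, rfl⟩ := exists_cx y
    obtain ⟨a', b', rfl⟩ := exists_cx y'
    rw [baseChange_cx, baseChange_cx, cx_inj] at hyy'
    -- Multiplication by `0` forgets all but the projection. Lifts of `u` to `D` and to `D'`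
    -- therefore have the same `0`-multiple, which lies in `D ∩ D' = 0`; as it still projects to
    -- `u`, so `u = 0`.
    obtain ⟨f, hf⟩ := exists_isSideSMul 0 a
    obtain ⟨g, hg⟩ := exists_isSideSMul 0 b
    obtain ⟨f', hf'⟩ := exists_isSideSMul 0 a'
    obtain ⟨g', hg'⟩ := exists_isSideSMul 0 b'
    have h₁ := hD.smul_mem 0 m 0 _ hy (cx f g) ⟨a, b, f, g, rfl, rfl, hf, hg⟩
    have h₂ := hD'.smul_mem 0 m 0 _ hy' (cx f' g') ⟨a', b', f', g', rfl, rfl, hf', hg'⟩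
    rw [hf'.eq_of_sideProj_eq hf hyy'.1, hg'.eq_of_sideProj_eq hg hyy'.2] at h₂
    have h₃ := cx_eq_zero.mp (Submodule.disjoint_def.mp (hc _).disjoint _ h₁ h₂)
    rw [baseChange_cx, ← hf.sideProj_eq, ← hg.sideProj_eq, h₃.1, h₃.2, map_zero, cx_zero]
  · rw [codisjoint_iff, eq_top_iff]
    rintro z -
    obtain ⟨a, b, rfl⟩ := exists_cx z
    obtain ⟨ξ, rfl⟩ := sideProj_surjective (I := I) (⟨m, 0⟩ : TotalSpace F E) a
    obtain ⟨η, rfl⟩ := sideProj_surjective (I := I) (⟨m, 0⟩ : TotalSpace F E) b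
    rw [← hD.map_side ⟨m, 0⟩, ← hD'.map_side ⟨m, 0⟩, ← Submodule.map_sup, (hc _).sup_eq_top]
    exact ⟨cx ξ η, trivial, baseChange_cx _ _ _⟩

/-- Conjugation commutes with the complexification of the real map `Φ_E`, so the conjugacy of `D`
and `D'` passes to their images. -/
theorem mem_side_iff_conj_mem
    {D D' : ∀ p : TotalSpace F E, Submodule ℂ (ℂ ⊗[ℝ] GenTE I F E p)}
    {U U' : ∀ m : M, Submodule ℂ (ℂ ⊗[ℝ] Side I E m)}
    (hD : IsSubDoubleVectorBundle I F E D U) (hD' : IsSubDoubleVectorBundle I F E D' U')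
    (hconj : ∀ p ξ, ξ ∈ D' p ↔ conj (GenTE I F E p) ξ ∈ D p) (m : M)
    (z : ℂ ⊗[ℝ] Side I E m) : z ∈ U' m ↔ conj (Side I E m) z ∈ U m := by
  rw [← hD.map_side ⟨m, 0⟩, ← hD'.map_side ⟨m, 0⟩, Submodule.mem_map, Submodule.mem_map]
  constructor
  · rintro ⟨y, hy, rfl⟩
    obtain ⟨a, b, rfl⟩ := exists_cx y
    refine ⟨cx a (-b), ?_, ?_⟩
    · rw [← conj_cx]
      exact (hconj _ _).mp hy
    · rw [baseChange_cx, baseChange_cx, conj_cx, map_neg]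
  · rintro ⟨y, hy, hyz⟩
    obtain ⟨a, b, rfl⟩ := exists_cx y
    obtain ⟨c, d, rfl⟩ := exists_cx z
    rw [baseChange_cx, conj_cx, cx_inj] at hyz
    refine ⟨cx a (-b), ?_, ?_⟩
    · rw [hconj, conj_cx, neg_neg]
      exact hy
    · rw [baseChange_cx, map_neg, hyz.1, hyz.2, neg_neg]

variable [FiniteDimensional ℝ EM] [FiniteDimensional ℝ F]

/-- The `i`-eigenbundle of a linear complex structure on `𝕋E` is a sub-double vector bundle. -/
theorem IsLinearEndomorphism.exists_isSubDoubleVectorBundle (hJ : ∀ p ξ, 𝒥 p (𝒥 p ξ) = -ξ)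
    (h : IsLinearEndomorphism I F E 𝒥) :
    ∃ U, IsSubDoubleVectorBundle I F E
      (fun p => Module.End.eigenspace ((𝒥 p).baseChange ℂ) Complex.I) U := by
  obtain ⟨j, hj, hΦ⟩ := h.side
  -- The side map inherits `j² = -1` because `Φ_E` is onto, already over the zero section.
  have hjj : ∀ m v, j m (j m v) = -v := by
    intro m v
    obtain ⟨ξ, rfl⟩ := sideProj_surjective (I := I) (⟨m, 0⟩ : TotalSpace F E) v
    have h₁ := hΦ ⟨m, 0⟩ (𝒥 ⟨m, 0⟩ ξ)
    rw [hJ, hΦ, map_neg] at h₁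
    exact h₁.symm
  have : ContMDiffVectorBundle ∞ (SideModel EM F) (Side I E) I := contMDiffVectorBundle_side
  have : ContMDiffVectorBundle ∞ (GenTangentModel (EM × F))
      (GenTangent (I.prod 𝓘(ℝ, F)) : TotalSpace F E → Type _) (I.prod 𝓘(ℝ, F)) :=
    contMDiffVectorBundle_genTangent
  refine ⟨fun m => Module.End.eigenspace ((j m).baseChange ℂ) Complex.I,
    isComplexSubbundle_eigenspace h.smooth hJ, isComplexSubbundle_eigenspace hj hjj,
    fun p => ?_, fun m e e' ξ hξ η hη ζ hs => ?_, fun r m e ξ hξ ζ hs => ?_⟩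
  · ext z
    rw [Submodule.mem_map]
    constructor
    · rintro ⟨y, hy, rfl⟩
      obtain ⟨a, b, rfl⟩ := exists_cx y
      rw [cx_mem_eigenspace_I (hJ p)] at hy
      rw [baseChange_cx, cx_mem_eigenspace_I (hjj p.1), hy, hΦ]
    · intro hz
      obtain ⟨a, b, rfl⟩ := exists_cx z
      rw [cx_mem_eigenspace_I (hjj p.1)] at hz
      obtain ⟨ξ, rfl⟩ := sideProj_surjective p b
      refine ⟨cx (𝒥 p ξ) ξ, (cx_mem_eigenspace_I (hJ p)).mpr rfl, ?_⟩
      rw [baseChange_cx, hz, hΦ]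
  · obtain ⟨a, b, c, d, f, g, rfl, rfl, rfl, h₁, h₂⟩ := hs
    rw [cx_mem_eigenspace_I (hJ _)] at hξ hη ⊢
    subst hξ hη
    -- Applying `𝒥` to the sum of the imaginary parts gives a sum of the real parts; by uniqueness
    -- it is the given one.
    exact h₁.unique (h.add _ _ _ _ _ _ h₂)
  · obtain ⟨a, b, f, g, rfl, rfl, h₁, h₂⟩ := hs
    rw [cx_mem_eigenspace_I (hJ _)] at hξ ⊢
    subst hξ
    exact h₁.unique (h.smul _ _ _ _ _ h₂)

theorem IsLinearGeneralisedComplex.isConjugateVBDiracPair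
    (h : IsLinearGeneralisedComplex I F E 𝒥) :
    IsConjugateVBDiracPair I F E (eigenbundle I F E 𝒥 Complex.I)
      (eigenbundle I F E 𝒥 (-Complex.I)) where
  plus := ⟨h.1.isComplexDirac_I, h.2.exists_isSubDoubleVectorBundle h.1.sq⟩
  minus := by
    refine ⟨h.1.isComplexDirac_neg_I, ?_⟩
    have := (h.2.neg h.1.sq).exists_isSubDoubleVectorBundle fun p ξ => by simp [h.1.sq]
    simp only [← eigenspace_neg_I] at this
    exact this
  transverse p := isCompl_eigenspace (h.1.sq p)
  conjugate p := mem_eigenspace_neg_I_iff_conj_mem (h.1.sq p)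

/-- A complex structure on `𝕋E` with eigenbundles that are sub-double vector bundles is linear. -/
theorem isLinearEndomorphism_of_isSubDoubleVectorBundle (hJ : ∀ p ξ, 𝒥 p (𝒥 p ξ) = -ξ)
    {U U' : ∀ m : M, Submodule ℂ (ℂ ⊗[ℝ] Side I E m)}
    (hD : IsSubDoubleVectorBundle I F E
      (fun p => Module.End.eigenspace ((𝒥 p).baseChange ℂ) Complex.I) U)
    (hD' : IsSubDoubleVectorBundle I F E
      (fun p => Module.End.eigenspace ((𝒥 p).baseChange ℂ) (-Complex.I)) U') :
    IsLinearEndomorphism I F E 𝒥 := by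
  choose j hjj hU _ using fun m => exists_complexStructure (U m) (U' m)
    (isCompl_side hD hD' (fun p => isCompl_eigenspace (hJ p)) m)
    (mem_side_iff_conj_mem hD hD' (fun p => mem_eigenspace_neg_I_iff_conj_mem (hJ p)) m)
  have hΦ : ∀ p ξ, sideProj I F E p (𝒥 p ξ) = j p.1 (sideProj I F E p ξ) := by
    intro p ξ
    have h₁ : cx (sideProj I F E p (𝒥 p ξ)) (sideProj I F E p ξ) ∈ U p.1 := by
      rw [← hD.map_side p, ← baseChange_cx]
      exact Submodule.mem_map_of_mem ((cx_mem_eigenspace_I (hJ p)).mpr rfl)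
    rwa [← hU, cx_mem_eigenspace_I (hjj p.1)] at h₁
  have hj : SmoothEndomorphism I (SideModel EM F) j := by
    refine smoothEndomorphism_of_isComplexSubbundle hjj ?_
    rw [show (fun m => Module.End.eigenspace ((j m).baseChange ℂ) Complex.I) = U from funext hU]
    exact hD.side_subbundle
  refine ⟨smoothEndomorphism_of_isComplexSubbundle hJ hD.subbundle, ⟨j, hj, hΦ⟩,
    fun m e e' ξ η ζ hs => ?_, fun r m e ξ ζ hs => ?_⟩
  -- The images have equal projections since `𝒥` covers `j`, so they have a sum `θ`. Closure of the
  -- eigenbundle puts `θ + iζ` in it, which forces `θ = 𝒥ζ`.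
  · obtain ⟨θ, hθ⟩ := exists_isSideAdd (ξ := 𝒥 ⟨m, e⟩ ξ) (η := 𝒥 ⟨m, e'⟩ η)
      (by rw [hΦ, hΦ, hs.sideProj_eq])
    have h₁ := hD.add_mem m e e' _ ((cx_mem_eigenspace_I (hJ ⟨m, e⟩)).mpr rfl) _
      ((cx_mem_eigenspace_I (hJ ⟨m, e'⟩)).mpr rfl) (cx θ ζ) ⟨_, _, _, _, _, _, rfl, rfl, rfl, hθ, hs⟩
    rw [cx_mem_eigenspace_I (hJ _)] at h₁
    rwa [← h₁]
  · obtain ⟨θ, hθ⟩ := exists_isSideSMul r (𝒥 ⟨m, e⟩ ξ)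
    have h₁ := hD.smul_mem r m e _ ((cx_mem_eigenspace_I (hJ ⟨m, e⟩)).mpr rfl) (cx θ ζ)
      ⟨_, _, _, _, rfl, rfl, hθ, hs⟩
    rw [cx_mem_eigenspace_I (hJ _)] at h₁
    rwa [← h₁]

theorem IsConjugateVBDiracPair.exists_isLinearGeneralisedComplex
    {D D' : ∀ p : TotalSpace F E, Submodule ℂ (ℂ ⊗[ℝ] GenTE I F E p)}
    (h : IsConjugateVBDiracPair I F E D D') :
    ∃ 𝒥, IsLinearGeneralisedComplex I F E 𝒥 ∧ eigenbundle I F E 𝒥 Complex.I = D ∧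
      eigenbundle I F E 𝒥 (-Complex.I) = D' := by
  choose 𝒥 hJ h₁ h₂ using fun p =>
    exists_complexStructure (D p) (D' p) (h.transverse p) (h.conjugate p)
  obtain rfl : (fun p => Module.End.eigenspace ((𝒥 p).baseChange ℂ) Complex.I) = D := funext h₁
  obtain rfl : (fun p => Module.End.eigenspace ((𝒥 p).baseChange ℂ) (-Complex.I)) = D' :=
    funext h₂
  obtain ⟨U, hU⟩ := h.plus.2
  obtain ⟨U', hU'⟩ := h.minus.2
  exact ⟨𝒥, ⟨h.plus.1.isGeneralisedComplex hJ,
    isLinearEndomorphism_of_isSubDoubleVectorBundle hJ hU hU'⟩, rfl, rfl⟩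

end Linear

end LinearGCS

end

theorem mainTheorem9
    {EM : Type*} [NormedAddCommGroup EM] [NormedSpace ℝ EM] [FiniteDimensional ℝ EM]
    {H : Type*} [TopologicalSpace H] (I : ModelWithCorners ℝ EM H) [I.Boundaryless]
    {M : Type*} [TopologicalSpace M] [T2Space M] [SecondCountableTopology M]
    [ChartedSpace H M] [IsManifold I ∞ M]
    (F : Type*) [NormedAddCommGroup F] [NormedSpace ℝ F] [FiniteDimensional ℝ F]
    (E : M → Type*) [∀ m, AddCommGroup (E m)] [∀ m, Module ℝ (E m)]
    [TopologicalSpace (TotalSpace F E)] [∀ m, TopologicalSpace (E m)]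
    [FiberBundle F E] [VectorBundle ℝ F E] [ContMDiffVectorBundle ∞ F E I] :
    Set.BijOn
      (fun 𝒥 : ∀ p : TotalSpace F E, LinearGCS.GenTE I F E p →ₗ[ℝ] LinearGCS.GenTE I F E p =>
        (LinearGCS.eigenbundle I F E 𝒥 Complex.I, LinearGCS.eigenbundle I F E 𝒥 (-Complex.I)))
      {𝒥 | LinearGCS.IsLinearGeneralisedComplex I F E 𝒥}
      {D | LinearGCS.IsConjugateVBDiracPair I F E D.1 D.2} := by
  refine ⟨fun 𝒥 h => h.isConjugateVBDiracPair, fun 𝒥 h 𝒥' h' heq => ?_, fun ⟨D, D'⟩ h => ?_⟩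
  · funext p
    exact LinearGCS.eq_of_eigenspace_eq (h.1.sq p) (h'.1.sq p)
      (congrFun (congrArg Prod.fst heq) p)
  · obtain ⟨𝒥, h𝒥, hD, hD'⟩ :=
      LinearGCS.IsConjugateVBDiracPair.exists_isLinearGeneralisedComplex h
    exact ⟨𝒥, h𝒥, Prod.ext hD hD'⟩
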